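/- Let $\mathcal C\subset\mathcal D\subseteq\mathbb Z_2^n$ be binary cyclic codes of dimensions $k_c<k_d$ with $\mathcal C^\perp\subsetneq\mathcal C$, let $p(x),q(x)$ be their generator polynomials, and put $t=k_d-k_c$. Let $\mathbf p_i,\mathbf q_i,\tilde{\mathbf p}_i,\tilde{\mathbf q}_i$ ($i\ge1$) be the coefficient vectors of $p$, of $q$, and of the reversed check polynomials of $\mathcal C$ and of $\mathcal D$, cyclically shifted to the right by $i-1$ positions. *Paired generators.* There exist vectors $\mathbf s^x_l,\mathbf s^z_l$ ($1\le l\le 2k_c-n$) and $\tilde{\mathbf t}_j,\mathbf t^x_j,\mathbf t^z_j$ ($1\le j\le t$) such that $\langle\mathbf s^x_l\rangle=\langle\mathbf s^z_l\rangle=\langle\mathbf p_l\rangle_{l\le 2k_c-n}$, $\langle\tilde{\mathbf t}_j\rangle=\langle\tilde{\mathbf p}_j\rangle_{j\le t}$, $\langle\tilde{\mathbf t}_j,\mathbf t^x_j\rangle=\langle\tilde{\mathbf t}_j,\mathbf t^z_j\rangle=\langle\tilde{\mathbf p}_j,\mathbf q'_j\rangle_{j\le t}$, where $\mathbf q'_m=\mathbf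 q_m+\sum_l(\mathbf q_m\cdot\mathbf s^x_l)\mathbf s^z_l$, and $\mathbf s^x_l\cdot\mathbf s^z_{l'}=\delta_{ll'}$, $\tilde{\mathbf t}_j\cdot\mathbf t^x_{j'}=\tilde{\mathbf t}_j\cdot\mathbf t^z_{j'}=\delta_{jj'}$, $\mathbf s^x_l\cdot\mathbf t^z_j=\mathbf s^z_l\cdot\mathbf t^x_j=\mathbf t^x_j\cdot\mathbf t^z_{j'}=0$. Fix any such choice. *The codes.* For $a_l,a_r\ge0$ and $\mathbf u\in\mathbb Z_2^n$ let $\hat X(\mathbf u)=X(\text{last }a_l\text{ bits of }\mathbf u\,|\,\mathbf u\,|\,\text{first }a_r\text{ bits of }\mathbf u)$ and $\hat Z(\mathbf u)=Z(\mathbf 0\,|\,\mathbf u\,|\,\mathbf 0)$, Pauli operators on $n+a_l+a_r$ qubits. Let $\mathcal B$ consist of $\hat X(\tilde{\mathbf q}_i),\hat Z(\tilde{\mathbf q}_i)$ ($i\le n-k_d$) and of the operators $Z_iZ_{i+n}$ ($1\le i\le a_l+a_r$). For vectors $\mathbf v,\mathbf w$ let $\mathcal X_{\mathbf v}=\{(-1)^{\tilde{\mathbf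 p}_j\cdot\mathbf v}\hat X(\tilde{\mathbf p}_j)\}_{j\le t}$ and $\mathcal Z_{\mathbf w}=\{(-1)^{\tilde{\mathbf p}_j\cdot\mathbf w}\hat Z(\tilde{\mathbf p}_j)\}_{j\le t}$. The following types of codes are given by the stabilizer and gauge groups of their inner codes, one inner code for each classical message; the gauge group is generated by $iI$, by the stabilizer, and by the listed extra generators. Put $\mathcal G_{\mathbf w}=\mathcal X_{\mathbf 0}\cup\{(-1)^{\mathbf q'_m\cdot\mathbf w}\hat Z(\mathbf q'_m)\}_{m\le t}$. - $\mathcal Q_1$: $a_l=a_r=0$, one message, stabilizer $\langle\mathcal B\rangle$, extra gauge generators $\hat X(\tilde{\mathbf t}_j),\hat Z(\tilde{\mathbf t}_j),\hat X(\mathbf t^x_j),\hat Z(\mathbf t^z_j)$. - $\mathcal Q_2$: $a_l+a_r<t$, one message, stabilizer $\langle\mathcal B,\mathcal Z_{\mathbf w}\rangle$ with $\mathbf w=\mathbf q_1$, extra gauge generators $\mathcal G_{\mathbf w}$. - $\mathcal Q_3$: $a_l+a_r<t$, messages $b\in\mathbb Z_2^t$, stabilizer $\langle\mathcal B,\mathcal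 X_{\mathbf v},\mathcal Z_{\mathbf w}\rangle$ with $\mathbf v=\sum_{m\le t}b_m\mathbf q_m$, $\mathbf w=\mathbf q_1$. - $\mathcal Q_4$ ($1\le y\le t-2$): $a_l+a_r<t-y$, messages $(b,c)\in\mathbb Z_2^t\times\mathbb Z_2^y$, stabilizer $\langle\mathcal B,\mathcal X_{\mathbf v},\mathcal Z_{\mathbf w}\rangle$ with $\mathbf v=\sum_{m\le t} b_m\mathbf q_m$, $\mathbf w=\mathbf q_1+\sum_{m=2}^{y+1}c_m\mathbf q_m$. - $\mathcal Q_5$: $a_l=a_r=0$, messages $(b,c)\in\mathbb Z_2^t\times\mathbb Z_2^t$, stabilizer $\langle\mathcal B,\mathcal X_{\mathbf v},\mathcal Z_{\mathbf w}\rangle$ with $\mathbf v=\sum_{m\le t} b_m\mathbf q_m$, $\mathbf w=\sum_{m\le t}c_m\mathbf q_m$. - $\mathcal Q_6$ ($1\le y\le t-2$): $a_l+a_r<t-y$, messages $c\in\mathbb Z_2^y$, stabilizer $\langle\mathcal B,\mathcal Z_{\mathbf w}\rangle$ with $\mathbf w=\mathbf q_1+\sum_{m=2}^{y+1}c_m\mathbf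 q_m$, extra gauge generators $\mathcal G_{\mathbf w}$. - $\mathcal Q_7$: $a_l=a_r=0$, messages $c\in\mathbb Z_2^t$, stabilizer $\langle\mathcal B,\mathcal Z_{\mathbf w}\rangle$ with $\mathbf w=\sum_{m\le t}c_m\mathbf q_m$, extra gauge generators $\mathcal G_{\mathbf w}$. The types $\mathcal Q_2,\mathcal Q_3,\mathcal Q_4,\mathcal Q_6$ are called synchronizable, the others non-synchronizable. *Parameters.* A code on $N$ qubits has $k$ logical qubits, $m$ classical bits and $r$ gauge qubits if there are Pauli operators $\bar X_i,\bar Z_i$ ($i\le N$) with square $I$ that satisfy the commutation relations of $X_i,Z_i$, a division of the $N$ indices into $k$ logical, $m$ classical, $r$ gauge and the remaining stabilizer ones, and an identification of the messages with $\mathbb Z_2^m$, such that the inner code with message $b$ has the stabilizer group generated by the $\bar Z_i$ of the stabilizer indices and the $(-1)^{b_i}\bar Z_i$ of the classical indices, and the gauge group generated by $iI$, all these $\bar Z_i$, and the pairs $\bar X_i,\bar Z_i$ of the gauge indices. A code on $n+a_l+a_r$ qubits corrects misalignment by up to $a_l$ qubits to the left and $a_r$ to the right if, in the absence of Pauli errors,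 measuring some commuting $n$-qubit Pauli operators on the received $n$ consecutive qubits has definite results, which determine the position of these qubits in the block for every (unknown) message; its synchronization distance is then $a_l+a_r+1$. For each type, the maximum synchronization distance $d_{\mathrm{sync,max}}$ is the largest synchronization distance $a_l+a_r+1$ over the pairs $(a_l,a_r)$ that the construction above admits and for which misalignment is corrected. *Claim.* For each type (with $y$ in the stated range) there are $r$ and $m$ such that, for every admitted $(a_l,a_r)$, the code has $2k_c-n$ logical qubits, $m$ classical bits and $r$ gauge qubits and corrects misalignment by up to $a_l$ qubits to the left and $a_r$ to the right. The maximum $d_{\mathrm{sync,max}}$ exists, and: 1. for every synchronizable type, $r+m+d_{\mathrm{sync,max}}=2(k_d-k_c)$, and $d_{\mathrm{sync,max}}>1$ if $k_d-k_c\ge2$; 2. for every non-synchronizable type, $d_{\mathrm{sync,max}}=1$ and $r+m+d_{\mathrm{sync,max}}=2(k_d-k_c)+1$. -/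

import Mathlib

open Polynomial

/-! ### Classical binary cyclic codes -/

/-- Binary row vectors `(c_0, …, c_{n-1})`. -/
abbrev BVec (n : ℕ) : Type := Fin n → ZMod 2

/-- The entry of `c` at the position `k` read modulo `n`. -/
def cyclicEntry {n : ℕ} [NeZero n] (c : BVec n) (k : ℤ) : ZMod 2 :=
  c (Fin.ofNat n (k % (n : ℤ)).toNat)

/-- The cyclic shift of `c` to the right by `α` positions (to the left if `α < 0`). -/
def cyclicShift {n : ℕ} [NeZero n] (c : BVec n) (α : ℤ) : BVec n :=
  fun i => cyclicEntry c ((i : ℤ) - α)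

/-- A linear code is cyclic if it is closed under cyclic shifts. -/
def IsCyclicCode {n : ℕ} [NeZero n] (C : Submodule (ZMod 2) (BVec n)) : Prop :=
  ∀ c ∈ C, ∀ α : ℤ, cyclicShift c α ∈ C

/-- The dual code. -/
def dualCode {n : ℕ} (C : Submodule (ZMod 2) (BVec n)) : Submodule (ZMod 2) (BVec n) where
  carrier := {w | ∀ c ∈ C, c ⬝ᵥ w = 0}
  add_mem' := by
    intro a b ha hb c hc
    rw [dotProduct_add, ha c hc, hb c hc, add_zero]
  zero_mem' := by
    intro c _
    exact dotProduct_zero c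
  smul_mem' := by
    intro r a ha c hc
    rw [dotProduct_smul, ha c hc, smul_zero]

/-- The vector of the coefficients of `1, x, …, x^{n-1}`. -/
def coeffVec (n : ℕ) (f : (ZMod 2)[X]) : BVec n := fun i => f.coeff i

/-- `p` is the generator polynomial of the cyclic code `C`: the monic polynomial of minimal degree
among the nonzero polynomials of degree less than `n` that represent code words of `C`. -/
structure IsGeneratorPolynomial {n : ℕ} (C : Submodule (ZMod 2) (BVec n))
    (p : (ZMod 2)[X]) : Prop where
  monic : p.Monic
  natDegree_lt : p.natDegree < n
  mem : coeffVec n p ∈ C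
  minimal : ∀ f : (ZMod 2)[X], f ≠ 0 → f.natDegree < n → coeffVec n f ∈ C →
    p.natDegree ≤ f.natDegree

/-- The check polynomial `(x^n - 1) / p(x)` with its coefficients in reverse order. -/
noncomputable def reversedCheck (n : ℕ) (p : (ZMod 2)[X]) : (ZMod 2)[X] :=
  ((X ^ n - 1) /ₘ p).reverse

/-- The vector of `x^i f(x)`: the vector of `f` shifted cyclically by `i` positions.
Indices start at `0`, so that `genVec n q 0` is the vector of `q(x)` itself. -/
def genVec (n : ℕ) [NeZero n] (f : (ZMod 2)[X]) (i : ℕ) : BVec n :=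
  cyclicShift (coeffVec n f) i

/-- A choice of paired generators for nested cyclic codes with generator polynomials `p` and `q`
and dimensions `kc` and `kd`: the vectors `s^x_l`, `s^z_l` span the space of the first `2 kc - n`
shifts of `p`, the vectors `t̃_j` span the space of the first `kd - kc` shifts of the reversed check
polynomial of `p`, and together with `t^x_m` or with `t^z_m` they span the space of these shifts
and of the vectors `q'_m = q_m + ∑_l (q_m · s^x_l) s^z_l`. The spanning vectors satisfy the duality
relations that turn the Pauli operators built from them into anticommuting pairs. -/
structure PairedGenerators (n : ℕ) [NeZero n] (kc kd : ℕ) (p q : (ZMod 2)[X]) where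
  sx : Fin (2 * kc - n) → BVec n
  sz : Fin (2 * kc - n) → BVec n
  tt : Fin (kd - kc) → BVec n
  tx : Fin (kd - kc) → BVec n
  tz : Fin (kd - kc) → BVec n
  span_sx : Submodule.span (ZMod 2) (Set.range sx) =
    Submodule.span (ZMod 2) (Set.range fun l : Fin (2 * kc - n) => genVec n p l)
  span_sz : Submodule.span (ZMod 2) (Set.range sz) =
    Submodule.span (ZMod 2) (Set.range fun l : Fin (2 * kc - n) => genVec n p l)
  span_tt : Submodule.span (ZMod 2) (Set.range tt) =
    Submodule.span (ZMod 2)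
      (Set.range fun j : Fin (kd - kc) => genVec n (reversedCheck n p) j)
  span_tx : Submodule.span (ZMod 2) (Set.range tt ∪ Set.range tx) =
    Submodule.span (ZMod 2)
      ((Set.range fun j : Fin (kd - kc) => genVec n (reversedCheck n p) j) ∪
        Set.range fun m : Fin (kd - kc) =>
          genVec n q m + ∑ l, (genVec n q m ⬝ᵥ sx l) • sz l)
  span_tz : Submodule.span (ZMod 2) (Set.range tt ∪ Set.range tz) =
    Submodule.span (ZMod 2)
      ((Set.range fun j : Fin (kd - kc) => genVec n (reversedCheck n p) j) ∪
        Set.range fun m : Fin (kd - kc) =>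
          genVec n q m + ∑ l, (genVec n q m ⬝ᵥ sx l) • sz l)
  sx_sz : ∀ l l', sx l ⬝ᵥ sz l' = if l = l' then 1 else 0
  tt_tx : ∀ j j', tt j ⬝ᵥ tx j' = if j = j' then 1 else 0
  tt_tz : ∀ j j', tt j ⬝ᵥ tz j' = if j = j' then 1 else 0
  sx_tz : ∀ l j, sx l ⬝ᵥ tz j = 0
  sz_tx : ∀ l j, sz l ⬝ᵥ tx j = 0
  tx_tz : ∀ j j', tx j ⬝ᵥ tz j' = 0

/-- The vector `q'_m = q_m + ∑_l (q_m · s^x_l) s^z_l`. -/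
def PairedGenerators.qPrime {n : ℕ} [NeZero n] {kc kd : ℕ} {p q : (ZMod 2)[X]}
    (V : PairedGenerators n kc kd p q) (m : ℕ) : BVec n :=
  genVec n q m + ∑ l, (genVec n q m ⬝ᵥ V.sx l) • V.sz l

/-! ### Pauli operators on `N` qubits -/

/-- Operators on `N` qubits, as matrices in the computational basis. -/
abbrev QOp (N : ℕ) : Type := Matrix (BVec N) (BVec N) ℂ

/-- The matrix of `X^{v_0} ⊗ ⋯ ⊗ X^{v_{N-1}}`, which maps `|b⟩` to `|b + v⟩`. -/
def xMatrix {N : ℕ} (v : BVec N) : QOp N :=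
  Matrix.of fun a b => if a = b + v then 1 else 0

/-- The matrix of `Z^{v_0} ⊗ ⋯ ⊗ Z^{v_{N-1}}`, which maps `|b⟩` to `(-1)^{v · b} |b⟩`. -/
def zMatrix {N : ℕ} (v : BVec N) : QOp N :=
  Matrix.diagonal fun b => (-1) ^ (v ⬝ᵥ b).val

theorem xMatrix_mul_self {N : ℕ} (v : BVec N) : xMatrix v * xMatrix v = 1 := by
  have hv : v + v = 0 := by
    funext i
    exact CharTwo.add_self_eq_zero (v i)
  ext a b
  rw [Matrix.mul_apply, Finset.sum_eq_single (b + v)]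
  · simp only [xMatrix, Matrix.of_apply, Matrix.one_apply, add_assoc, hv, add_zero, if_true,
      mul_one]
  · intro c _ hc
    simp [xMatrix, hc]
  · intro h
    exact absurd (Finset.mem_univ _) h

theorem zMatrix_mul_self {N : ℕ} (v : BVec N) : zMatrix v * zMatrix v = 1 := by
  rw [zMatrix, Matrix.diagonal_mul_diagonal, ← Matrix.diagonal_one]
  congr 1
  funext b
  rw [← pow_add, ← two_mul, pow_mul]
  simp

/-- The Pauli operator `X(v)`. -/
def pauliX {N : ℕ} (v : BVec N) : (QOp N)ˣ :=
  ⟨xMatrix v, xMatrix v, xMatrix_mul_self v, xMatrix_mul_self v⟩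

/-- The Pauli operator `Z(v)`. -/
def pauliZ {N : ℕ} (v : BVec N) : (QOp N)ˣ :=
  ⟨zMatrix v, zMatrix v, zMatrix_mul_self v, zMatrix_mul_self v⟩

/-- The scalar operator `i I`. -/
noncomputable def iOp (N : ℕ) : (QOp N)ˣ :=
  ⟨Complex.I • 1, (-Complex.I) • 1, by simp [smul_smul], by simp [smul_smul]⟩

/-- The scalar operator `(-1)^e I`. -/
def signOp (N : ℕ) (e : ZMod 2) : (QOp N)ˣ := (-1) ^ e.val

/-- The Pauli group on `N` qubits. -/
noncomputable def pauliGroup (N : ℕ) : Subgroup (QOp N)ˣ :=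
  Subgroup.closure ({iOp N} ∪ Set.range pauliX ∪ Set.range pauliZ)

/-- Virtual Pauli operators: Pauli operators `X̄_i`, `Z̄_i` that satisfy the relations of the
single-qubit operators `X_i`, `Z_i`. -/
structure IsVirtualPauliFamily {N : ℕ} {σ : Type} (Xb Zb : σ → (QOp N)ˣ) : Prop where
  mem_x : ∀ i, Xb i ∈ pauliGroup N
  mem_z : ∀ i, Zb i ∈ pauliGroup N
  sq_x : ∀ i, Xb i * Xb i = 1
  sq_z : ∀ i, Zb i * Zb i = 1
  comm_xx : ∀ i j, Xb i * Xb j = Xb j * Xb i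
  comm_zz : ∀ i j, Zb i * Zb j = Zb j * Zb i
  comm_xz : ∀ i j, i ≠ j → Xb i * Zb j = Zb j * Xb i
  anticomm : ∀ i, Xb i * Zb i = -(Zb i * Xb i)

/-! ### Hybrid subsystem codes -/

/-- The data of a hybrid subsystem code on `N` qubits in the stabilizer formalism: a set of
classical messages and, for each message, the stabilizer group and the gauge group of the inner
(subsystem) code that carries this message. -/
structure HybridSubsystemCode (N : ℕ) where
  Message : Type
  stab : Message → Subgroup (QOp N)ˣ
  gauge : Message → Subgroup (QOp N)ˣ

/-- The code has `k` logical qubits, `m` classical bits and `r` gauge qubits: the `N` virtual qubits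
are divided into `k` logical ones, `m` classical ones, `r` gauge ones and `s` stabilizer ones.
The messages are the `m`-bit strings; the stabilizer group of the inner code with message `b` is
generated by the operators `Z̄` of the stabilizer qubits and by the `(-1)^{b_j} Z̄_j` of the
classical qubits; its gauge group is generated by `i I`, by the `Z̄` of the stabilizer and classical
qubits, and by the pairs `X̄`, `Z̄` of the gauge qubits. -/
def HybridSubsystemCode.HasParameters {N : ℕ} (Q : HybridSubsystemCode N) (k m r : ℕ) : Prop :=
  ∃ (s : ℕ) (_ : k + m + r + s = N)
    (Xb Zb : Fin k ⊕ Fin m ⊕ Fin r ⊕ Fin s → (QOp N)ˣ) (φ : Q.Message ≃ BVec m),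
    IsVirtualPauliFamily Xb Zb ∧
    (∀ b, Q.stab b = Subgroup.closure
      ((Set.range fun j : Fin m => signOp N (φ b j) * Zb (.inr (.inl j))) ∪
        (Set.range fun i : Fin s => Zb (.inr (.inr (.inr i)))))) ∧
    (∀ b, Q.gauge b = Subgroup.closure
      ({iOp N} ∪
        (Set.range fun j : Fin m => Zb (.inr (.inl j))) ∪
        (Set.range fun g : Fin r => Xb (.inr (.inr (.inl g)))) ∪
        (Set.range fun g : Fin r => Zb (.inr (.inr (.inl g)))) ∪
        (Set.range fun i : Fin s => Zb (.inr (.inr (.inr i))))))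

/-- The vector on `n + al + ar` positions that is `u` on the `n` consecutive positions
`s, …, s + n - 1` and `0` elsewhere. -/
def placeAt {n : ℕ} [NeZero n] (al ar s : ℕ) (u : BVec n) : BVec (n + al + ar) :=
  fun i => if s ≤ (i : ℕ) ∧ (i : ℕ) < s + n then cyclicEntry u ((i : ℤ) - s) else 0

/-- The vector (last `al` bits of `u` | `u` | first `ar` bits of `u`). -/
def cyclicExtension {n : ℕ} [NeZero n] (al ar : ℕ) (u : BVec n) : BVec (n + al + ar) :=
  fun i => cyclicEntry u ((i : ℤ) - al)

/-- A code on `n + al + ar` qubits, whose main block consists of the qubits `al, …, al + n - 1`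
(counted from `0`), corrects misalignment by up to `al` qubits to the left and up to `ar` qubits to
the right. The receiver handles the `n` consecutive qubits that start at the qubit `s = al + α`,
where `-al ≤ α ≤ ar` is unknown, i.e. `0 ≤ s ≤ al + ar`. There are commuting `n`-qubit Pauli
operators `i^{e_j} X(u_j) Z(w_j)` such that measuring them on the received `n` qubits has a definite
result (`(-1)^{out b s j}` times the operator on these qubits is a stabilizer of the inner code with
message `b`), and the results determine `s`, whatever the unknown message is. -/
def HybridSubsystemCode.CorrectsMisalignment {n : ℕ} [NeZero n] {al ar : ℕ}
    (Q : HybridSubsystemCode (n + al + ar)) : Prop :=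
  ∃ (J : ℕ) (e : Fin J → ℕ) (u w : Fin J → BVec n) (out : Q.Message → ℕ → BVec J),
    (∀ j j', pauliX (u j) * pauliZ (w j) * (pauliX (u j') * pauliZ (w j')) =
      pauliX (u j') * pauliZ (w j') * (pauliX (u j) * pauliZ (w j))) ∧
    (∀ b, ∀ s ≤ al + ar, ∀ j,
      signOp _ (out b s j) *
        (iOp _ ^ e j * pauliX (placeAt al ar s (u j)) * pauliZ (placeAt al ar s (w j))) ∈
          Q.stab b) ∧
    (∀ b b', ∀ s ≤ al + ar, ∀ s' ≤ al + ar, out b s = out b' s' → s = s')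

/-! ### The family of synchronizable hybrid subsystem codes -/

/-- The seven types of codes of the family. -/
inductive CodeKind : Type
  /-- subsystem code -/
  | Q1 : CodeKind
  /-- synchronizable subsystem code -/
  | Q2 : CodeKind
  /-- synchronizable hybrid code -/
  | Q3 : CodeKind
  /-- synchronizable hybrid code with `y` more classical bits -/
  | Q4 (y : ℕ) : CodeKind
  /-- hybrid code -/
  | Q5 : CodeKind
  /-- synchronizable hybrid subsystem code with `y` classical bits -/
  | Q6 (y : ℕ) : CodeKind
  /-- hybrid subsystem code -/
  | Q7 : CodeKind

namespace CodeKind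

/-- The range of the parameter `y`, where `t = kd - kc`. -/
def Valid (t : ℕ) : CodeKind → Prop
  | Q4 y => 1 ≤ y ∧ y + 2 ≤ t
  | Q6 y => 1 ≤ y ∧ y + 2 ≤ t
  | _ => True

/-- The types of codes that are constructed with a marker and with ancilla qubits. -/
def IsSynchronizable : CodeKind → Prop
  | Q2 => True
  | Q3 => True
  | Q4 _ => True
  | Q6 _ => True
  | _ => False

/-- The requirement of the construction on the numbers `al`, `ar` of ancilla qubits. -/
def Admissible (t : ℕ) : CodeKind → ℕ → ℕ → Prop
  | Q2, al, ar => al + ar < t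
  | Q3, al, ar => al + ar < t
  | Q4 y, al, ar => al + ar < t - y
  | Q6 y, al, ar => al + ar < t - y
  | _, al, ar => al = 0 ∧ ar = 0

/-- The number of the message bits `b_m`, which the operators `Z(∑ b_m q_m)` encode. -/
def numB (t : ℕ) : CodeKind → ℕ
  | Q3 => t
  | Q4 _ => t
  | Q5 => t
  | _ => 0

/-- The number of the message bits `c_m`, which the operators `X(∑ c_m q_m)` encode. -/
def numC (t : ℕ) : CodeKind → ℕ
  | Q4 y => y
  | Q5 => t
  | Q6 y => y
  | Q7 => t
  | _ => 0

end CodeKind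

section Family

variable {n : ℕ} [NeZero n] {kc kd : ℕ} {p q : (ZMod 2)[X]}

/-- The vector `∑_m b_m q_m`, with `m` from `1`, that determines the phases of the `X`-type
stabilizers. -/
def phaseX (n : ℕ) [NeZero n] (q : (ZMod 2)[X]) {β : ℕ} (b : BVec β) : BVec n :=
  ∑ m, b m • genVec n q m

/-- The vector that determines the phases of the `Z`-type stabilizers: `q_1 + ∑_m c_m q_m` with `m`
from `2` (where `q_1` is the marker) for the synchronizable types, `∑_m c_m q_m` with `m` from `1`
for the other ones. -/
def phaseZ (n : ℕ) [NeZero n] (q : (ZMod 2)[X]) (κ : CodeKind) {γ : ℕ} (c : BVec γ) : BVec n :=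
  match κ with
  | .Q1 | .Q5 | .Q7 => ∑ m, c m • genVec n q m
  | .Q2 | .Q3 | .Q4 _ | .Q6 _ => genVec n q 0 + ∑ m : Fin γ, c m • genVec n q (m + 1)

/-- Generators common to all types: the encoded `X(q̃_i)` and `Z(q̃_i)`, and the operators `Z Z` on
the qubits at distance `n` that each ancilla qubit contributes. -/
def commonGenerators (n : ℕ) [NeZero n] (kd : ℕ) (q : (ZMod 2)[X]) (al ar : ℕ) :
    Set (QOp (n + al + ar))ˣ :=
  (Set.range fun i : Fin (n - kd) =>
    pauliX (cyclicExtension al ar (genVec n (reversedCheck n q) i))) ∪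
  (Set.range fun i : Fin (n - kd) =>
    pauliZ (placeAt al ar al (genVec n (reversedCheck n q) i))) ∪
  (Set.range fun i : Fin (al + ar) =>
    pauliZ (fun x : Fin (n + al + ar) =>
      if (x : ℕ) = i ∨ (x : ℕ) = i + n then 1 else 0))

/-- The encoded `X(p̃_j)` with the phases `(-1)^{p̃_j · v}`. -/
def xGenerators (n : ℕ) [NeZero n] (t : ℕ) (p : (ZMod 2)[X]) (al ar : ℕ) (v : BVec n) :
    Set (QOp (n + al + ar))ˣ :=
  Set.range fun j : Fin t =>
    signOp _ (genVec n (reversedCheck n p) j ⬝ᵥ v) *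
      pauliX (cyclicExtension al ar (genVec n (reversedCheck n p) j))

/-- The encoded `Z(p̃_j)` with the phases `(-1)^{p̃_j · w}`. -/
def zGenerators (n : ℕ) [NeZero n] (t : ℕ) (p : (ZMod 2)[X]) (al ar : ℕ) (w : BVec n) :
    Set (QOp (n + al + ar))ˣ :=
  Set.range fun j : Fin t =>
    signOp _ (genVec n (reversedCheck n p) j ⬝ᵥ w) *
      pauliZ (placeAt al ar al (genVec n (reversedCheck n p) j))

/-- Stabilizer generators of the inner code with phase vectors `v` (for `X`) and `w` (for `Z`). -/
def stabGenerators (n : ℕ) [NeZero n] (kc kd : ℕ) (p q : (ZMod 2)[X]) (κ : CodeKind)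
    (al ar : ℕ) (v w : BVec n) : Set (QOp (n + al + ar))ˣ :=
  match κ with
  | .Q1 => commonGenerators n kd q al ar
  | .Q2 | .Q6 _ | .Q7 =>
      commonGenerators n kd q al ar ∪ zGenerators n (kd - kc) p al ar w
  | .Q3 | .Q4 _ | .Q5 =>
      commonGenerators n kd q al ar ∪ zGenerators n (kd - kc) p al ar w ∪
        xGenerators n (kd - kc) p al ar v

/-- Generators of the gauge group besides `i I` and the stabilizer generators. -/
def gaugeGenerators (V : PairedGenerators n kc kd p q) (κ : CodeKind) (al ar : ℕ)
    (w : BVec n) : Set (QOp (n + al + ar))ˣ :=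
  match κ with
  | .Q1 =>
      (Set.range fun j => pauliX (cyclicExtension al ar (V.tt j))) ∪
      (Set.range fun j => pauliZ (placeAt al ar al (V.tt j))) ∪
      (Set.range fun m => pauliX (cyclicExtension al ar (V.tx m))) ∪
      (Set.range fun m => pauliZ (placeAt al ar al (V.tz m)))
  | .Q2 | .Q6 _ | .Q7 =>
      xGenerators n (kd - kc) p al ar 0 ∪
      (Set.range fun m : Fin (kd - kc) =>
        signOp _ (V.qPrime m ⬝ᵥ w) * pauliZ (placeAt al ar al (V.qPrime m)))
  | .Q3 | .Q4 _ | .Q5 => ∅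

/-- The code of type `κ` with `al` ancilla qubits on the left and `ar` on the right of the main
block of `n` qubits. Its messages are the pairs `(b, c)` of bit strings. -/
noncomputable def familyCode (V : PairedGenerators n kc kd p q) (κ : CodeKind) (al ar : ℕ) :
    HybridSubsystemCode (n + al + ar) where
  Message := BVec (κ.numB (kd - kc)) × BVec (κ.numC (kd - kc))
  stab := fun bc => Subgroup.closure
    (stabGenerators n kc kd p q κ al ar (phaseX n q bc.1) (phaseZ n q κ bc.2))
  gauge := fun bc => Subgroup.closure
    ({iOp _} ∪ stabGenerators n kc kd p q κ al ar (phaseX n q bc.1) (phaseZ n q κ bc.2) ∪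
      gaugeGenerators V κ al ar (phaseZ n q κ bc.2))

/-- The synchronization distances `al + ar + 1` of the codes of type `κ` that the construction
provides, i.e. over all admissible `al`, `ar` for which misalignment by up to `al` qubits to the left
and up to `ar` qubits to the right can be corrected. -/
def syncDistances (V : PairedGenerators n kc kd p q) (κ : CodeKind) : Set ℕ :=
  {d | ∃ al ar : ℕ, κ.Admissible (kd - kc) al ar ∧
    (familyCode V κ al ar).CorrectsMisalignment ∧ d = al + ar + 1}

end Family

/-!
Everything about the codes is linear algebra over `𝔽₂`. The three facts on the classical codes that
matter are that the first `2 kc - n` shifts of `p` complement `C^⊥` in `C`, that the first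
`t = kd - kc` shifts of `q` complement `C` in `D`, and that the first `t` shifts of the reversed check
polynomial of `C` complement `D^⊥` in `C^⊥`; in each case the degrees of the shifts fill the gap
between the degrees of two generators (`span_genVec_sup_of_finrank`). As `C^⊥` is the radical of the
form on `C`, the form is nondegenerate on the first complement (`IsNestedPair.exists_dual_p`), and
`C^⊥ / D^⊥` is paired perfectly with `D / C`, which gives a basis `τ` of the third complement dual to
the vectors `q_m` (`IsNestedPair.exists_dual_q`). The paired generators are built from these bases.

For the parameters, `X(u)` and `Z(v)` commute up to the sign `(-1)^{u · v}`, so that dual families of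
binary vectors of length `N` are the same as virtual Pauli operators
(`isVirtualPauliFamily_of_dual`). The vectors `s^x, s^z`, then `τ` with a corrected `q'`, then `q'`
with `τ`, and the ancilla vectors are dual pairs; the vectors `q̃_i` occur once as `X`-type and once as
`Z`-type operators and lack partners, which exist by linear independence (`exists_dual_completion`).
Since a signed Pauli operator depends multiplicatively on its vector, each generating set may be
replaced by the one built from another basis of its span (`closure_range_eq_spanImage`). In terms of
`τ` the phases are just the message bits, as `τ_j · ∑ b_m q_m = b_j`, so the pairs `X̂(τ_j)` and
`Ẑ(τ_j)` become gauge, classical or stabilizer qubits according to the type of the code.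

For the synchronization, the operators `Z Z` on qubits at distance `n` allow to move a `Z`-type
stabilizer from one window of `n` qubits to another after a cyclic shift
(`pauliZ_placeMap_add_mem`). Measuring shifts of the `Ẑ(τ_j)` on the received window yields the
coefficients modulo `C` of the phase vector `q_1 + ∑ c_m q_{m+1}`, shifted by a number `a` of positions
that is determined by the misalignment. Because `a + γ < t`, where `γ` is the number of the bits `c_m`,
this shift is `q_{a+1}` plus vectors `q_m` with `m > a + 1`, so that the first nonzero coefficient shows
`a` whatever the message is (`correctsMisalignment_of_marker`).
-/

/-! ### Pauli operators -/

theorem ZMod.two_cases (a : ZMod 2) : a = 0 ∨ a = 1 := by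
  decide +revert

theorem neg_one_pow_val_add {R : Type*} [Monoid R] [HasDistribNeg R] (a b : ZMod 2) :
    (-1 : R) ^ (a + b).val = (-1) ^ a.val * (-1) ^ b.val := by
  have h2 : (1 + 1 : ZMod 2) = 0 := rfl
  rcases ZMod.two_cases a with rfl | rfl <;> rcases ZMod.two_cases b with rfl | rfl <;>
    simp [ZMod.val_one, h2]

theorem signOp_add (N : ℕ) (a b : ZMod 2) : signOp N (a + b) = signOp N a * signOp N b :=
  neg_one_pow_val_add a b

@[simp] theorem signOp_zero (N : ℕ) : signOp N 0 = 1 := by simp [signOp]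

@[simp] theorem signOp_one (N : ℕ) : signOp N 1 = -1 := by simp [signOp, ZMod.val_one]

theorem signOp_comm {N : ℕ} (a : ZMod 2) (g : (QOp N)ˣ) : signOp N a * g = g * signOp N a :=
  (((Commute.one_left g).neg_left).pow_left _).eq

theorem signOp_mul_mul_signOp_mul {N : ℕ} (a b : ZMod 2) (g h : (QOp N)ˣ) :
    signOp N a * g * (signOp N b * h) = signOp N (a + b) * (g * h) := by
  rw [signOp_add, mul_assoc, mul_assoc, ← mul_assoc g, ← signOp_comm b g, mul_assoc]

theorem iOp_mul_self (N : ℕ) : iOp N * iOp N = signOp N 1 := by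
  ext1
  simp [iOp, smul_smul]

theorem signOp_mem {N : ℕ} {H : Subgroup (QOp N)ˣ} (hH : iOp N ∈ H) (e : ZMod 2) :
    signOp N e ∈ H := by
  fin_cases e
  · exact (signOp_zero N).symm ▸ H.one_mem
  · exact iOp_mul_self N ▸ H.mul_mem hH hH

theorem pauliX_add {N : ℕ} (u v : BVec N) : pauliX (u + v) = pauliX u * pauliX v := by
  ext1
  ext a b
  change xMatrix (u + v) a b = (xMatrix u * xMatrix v) a b
  rw [Matrix.mul_apply, Finset.sum_eq_single (b + v)]
  · simp [xMatrix, add_assoc, add_comm v u]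
  · intro c _ hc
    simp [xMatrix, hc]
  · intro h
    exact absurd (Finset.mem_univ _) h

theorem pauliZ_add {N : ℕ} (u v : BVec N) : pauliZ (u + v) = pauliZ u * pauliZ v := by
  ext1
  change zMatrix (u + v) = zMatrix u * zMatrix v
  simp only [zMatrix, Matrix.diagonal_mul_diagonal, add_dotProduct, neg_one_pow_val_add]

theorem pauliX_mul_self {N : ℕ} (u : BVec N) : pauliX u * pauliX u = 1 :=
  Units.ext (xMatrix_mul_self u)

theorem pauliZ_mul_self {N : ℕ} (u : BVec N) : pauliZ u * pauliZ u = 1 :=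
  Units.ext (zMatrix_mul_self u)

theorem pauliX_zero (N : ℕ) : pauliX (0 : BVec N) = 1 := by
  have h := pauliX_add (0 : BVec N) 0
  rw [add_zero] at h
  exact left_eq_mul.mp h

theorem pauliZ_zero (N : ℕ) : pauliZ (0 : BVec N) = 1 := by
  have h := pauliZ_add (0 : BVec N) 0
  rw [add_zero] at h
  exact left_eq_mul.mp h

theorem pauliX_comm {N : ℕ} (u v : BVec N) : pauliX u * pauliX v = pauliX v * pauliX u := by
  rw [← pauliX_add, add_comm, pauliX_add]

theorem pauliZ_comm {N : ℕ} (u v : BVec N) : pauliZ u * pauliZ v = pauliZ v * pauliZ u := by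
  rw [← pauliZ_add, add_comm, pauliZ_add]

theorem pauliX_mul_pauliZ {N : ℕ} (u w : BVec N) :
    pauliX u * pauliZ w = signOp N (u ⬝ᵥ w) * (pauliZ w * pauliX u) := by
  have hs : ((signOp N (u ⬝ᵥ w) : (QOp N)ˣ) : QOp N) = ((-1 : ℂ) ^ (u ⬝ᵥ w).val) • 1 := by
    generalize u ⬝ᵥ w = e
    fin_cases e
    · change ((signOp N 0 : (QOp N)ˣ) : QOp N) = ((-1 : ℂ) ^ (0 : ZMod 2).val) • 1
      simp
    · change ((signOp N 1 : (QOp N)ˣ) : QOp N) = ((-1 : ℂ) ^ (1 : ZMod 2).val) • 1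
      simp [ZMod.val_one]
  ext1
  rw [Units.val_mul, Units.val_mul, hs, smul_mul_assoc, one_mul]
  change xMatrix u * zMatrix w = (-1 : ℂ) ^ (u ⬝ᵥ w).val • (zMatrix w * xMatrix u)
  ext a b
  rw [Matrix.smul_apply, zMatrix, Matrix.mul_diagonal, Matrix.diagonal_mul]
  by_cases h : a = b + u
  · subst h
    simp only [xMatrix, Matrix.of_apply, if_true, one_mul, mul_one, smul_eq_mul]
    rw [← neg_one_pow_val_add, dotProduct_add, dotProduct_comm w u, add_left_comm,
      CharTwo.add_self_eq_zero, add_zero]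
  · simp [xMatrix, h]

theorem iOp_mem_pauliGroup (N : ℕ) : iOp N ∈ pauliGroup N :=
  Subgroup.subset_closure (.inl (.inl rfl))

theorem pauliX_mem_pauliGroup {N : ℕ} (u : BVec N) : pauliX u ∈ pauliGroup N :=
  Subgroup.subset_closure (.inl (.inr ⟨u, rfl⟩))

theorem pauliZ_mem_pauliGroup {N : ℕ} (u : BVec N) : pauliZ u ∈ pauliGroup N :=
  Subgroup.subset_closure (.inr ⟨u, rfl⟩)

/-! ### Groups of signed Pauli operators -/

/-- The homomorphism `u ↦ (-1)^{u · v} X(f u)`. -/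
def signedX {n N : ℕ} (f : BVec n →ₗ[ZMod 2] BVec N) (v : BVec n) :
    Multiplicative (BVec n) →* (QOp N)ˣ where
  toFun u := signOp N (u.toAdd ⬝ᵥ v) * pauliX (f u.toAdd)
  map_one' := by simp [pauliX_zero]
  map_mul' a b := by
    rw [toAdd_mul, add_dotProduct, map_add, pauliX_add, signOp_mul_mul_signOp_mul]

/-- The homomorphism `u ↦ (-1)^{u · w} Z(f u)`. -/
def signedZ {n N : ℕ} (f : BVec n →ₗ[ZMod 2] BVec N) (w : BVec n) :
    Multiplicative (BVec n) →* (QOp N)ˣ where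
  toFun u := signOp N (u.toAdd ⬝ᵥ w) * pauliZ (f u.toAdd)
  map_one' := by simp [pauliZ_zero]
  map_mul' a b := by
    rw [toAdd_mul, add_dotProduct, map_add, pauliZ_add, signOp_mul_mul_signOp_mul]

theorem signedZ_apply {n N : ℕ} (f : BVec n →ₗ[ZMod 2] BVec N) (w u : BVec n) :
    signedZ f w (.ofAdd u) = signOp N (u ⬝ᵥ w) * pauliZ (f u) := rfl

/-- The image of a space `U` of binary vectors under a homomorphism to a multiplicative group. -/
def spanImage {W G : Type*} [AddCommGroup W] [Module (ZMod 2) W] [Group G]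
    (θ : Multiplicative W →* G) (U : Submodule (ZMod 2) W) : Subgroup G :=
  U.toAddSubgroup.toSubgroup.map θ

section SpanImage

variable {W G : Type*} [AddCommGroup W] [Module (ZMod 2) W] [Group G]

theorem apply_mem_spanImage (θ : Multiplicative W →* G) {U : Submodule (ZMod 2) W} {u : W}
    (hu : u ∈ U) : θ (.ofAdd u) ∈ spanImage θ U := ⟨.ofAdd u, hu, rfl⟩

theorem closure_range_eq_spanImage {ι : Type*} (θ : Multiplicative W →* G) (g : ι → W) :
    Subgroup.closure (Set.range fun i => θ (.ofAdd (g i))) =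
      spanImage θ (Submodule.span (ZMod 2) (Set.range g)) := by
  apply le_antisymm
  · rw [Subgroup.closure_le]
    rintro _ ⟨i, rfl⟩
    exact apply_mem_spanImage θ (Submodule.subset_span ⟨i, rfl⟩)
  · rintro _ ⟨u, hu, rfl⟩
    change Multiplicative.toAdd u ∈ Submodule.span (ZMod 2) (Set.range g) at hu
    change θ (.ofAdd u.toAdd) ∈ _
    generalize u.toAdd = x at hu
    induction hu using Submodule.span_induction with
    | mem x hx =>
      obtain ⟨i, rfl⟩ := hx
      exact Subgroup.subset_closure ⟨i, rfl⟩
    | zero => rw [ofAdd_zero, map_one]; exact Subgroup.one_mem _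
    | add x y _ _ hx hy => rw [ofAdd_add, map_mul]; exact Subgroup.mul_mem _ hx hy
    | smul a x _ hx =>
      fin_cases a
      · change θ (.ofAdd ((0 : ZMod 2) • x)) ∈ _
        rw [zero_smul, ofAdd_zero, map_one]
        exact Subgroup.one_mem _
      · change θ (.ofAdd ((1 : ZMod 2) • x)) ∈ _
        rwa [one_smul]

theorem spanImage_sup (θ : Multiplicative W →* G) (U U' : Submodule (ZMod 2) W) :
    spanImage θ (U ⊔ U') = spanImage θ U ⊔ spanImage θ U' := by
  rw [spanImage, spanImage, spanImage, ← Subgroup.map_sup]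
  congr 1
  apply le_antisymm
  · intro x hx
    obtain ⟨a, ha, b, hb, hab⟩ :=
      Submodule.mem_sup.mp (show Multiplicative.toAdd x ∈ U ⊔ U' from hx)
    have : x = Multiplicative.ofAdd a * Multiplicative.ofAdd b := hab.symm
    rw [this]
    exact Subgroup.mul_mem_sup ha hb
  · exact sup_le (fun x hx => (le_sup_left : U ≤ U ⊔ U') hx)
      (fun x hx => (le_sup_right : U' ≤ U ⊔ U') hx)

end SpanImage

/-- In the presence of `i I` the signs of generators do not matter. -/
theorem signOp_mul_mem_iff {N : ℕ} {H : Subgroup (QOp N)ˣ} (hH : iOp N ∈ H) (e : ZMod 2)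
    (g : (QOp N)ˣ) : signOp N e * g ∈ H ↔ g ∈ H :=
  H.mul_mem_cancel_left (signOp_mem hH e)

/-- The vectors `u` for which a group of operators contains `X(f u)`. -/
def xPart {n N : ℕ} (H : Subgroup (QOp N)ˣ) (f : BVec n →ₗ[ZMod 2] BVec N) :
    Submodule (ZMod 2) (BVec n) where
  carrier := {u | pauliX (f u) ∈ H}
  add_mem' ha hb := by
    rw [Set.mem_ofPred_eq, map_add, pauliX_add]
    exact H.mul_mem ha hb
  zero_mem' := by
    rw [Set.mem_ofPred_eq, map_zero, pauliX_zero]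
    exact H.one_mem
  smul_mem' a u hu := by
    rcases ZMod.two_cases a with rfl | rfl
    · rw [zero_smul, Set.mem_ofPred_eq, map_zero, pauliX_zero]
      exact H.one_mem
    · rwa [one_smul]

/-- The vectors `u` for which a group of operators contains `Z(f u)`. -/
def zPart {n N : ℕ} (H : Subgroup (QOp N)ˣ) (f : BVec n →ₗ[ZMod 2] BVec N) :
    Submodule (ZMod 2) (BVec n) where
  carrier := {u | pauliZ (f u) ∈ H}
  add_mem' ha hb := by
    rw [Set.mem_ofPred_eq, map_add, pauliZ_add]
    exact H.mul_mem ha hb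
  zero_mem' := by
    rw [Set.mem_ofPred_eq, map_zero, pauliZ_zero]
    exact H.one_mem
  smul_mem' a u hu := by
    rcases ZMod.two_cases a with rfl | rfl
    · rw [zero_smul, Set.mem_ofPred_eq, map_zero, pauliZ_zero]
      exact H.one_mem
    · rwa [one_smul]

/-! ### Virtual Pauli families -/

theorem IsVirtualPauliFamily.comp {N : ℕ} {σ τ : Type} {Xb Zb : σ → (QOp N)ˣ}
    (h : IsVirtualPauliFamily Xb Zb) {f : τ → σ} (hf : Function.Injective f) :
    IsVirtualPauliFamily (Xb ∘ f) (Zb ∘ f) where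
  mem_x _ := h.mem_x _
  mem_z _ := h.mem_z _
  sq_x _ := h.sq_x _
  sq_z _ := h.sq_z _
  comm_xx _ _ := h.comm_xx _ _
  comm_zz _ _ := h.comm_zz _ _
  comm_xz _ _ hij := h.comm_xz _ _ (hf.ne hij)
  anticomm _ := h.anticomm _

theorem IsVirtualPauliFamily.signed {N : ℕ} {σ : Type} {Xb Zb : σ → (QOp N)ˣ}
    (h : IsVirtualPauliFamily Xb Zb) (e : σ → ZMod 2) :
    IsVirtualPauliFamily Xb (fun i => signOp N (e i) * Zb i) where
  mem_x := h.mem_x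
  mem_z i := Subgroup.mul_mem _ (signOp_mem (iOp_mem_pauliGroup N) _) (h.mem_z i)
  sq_x := h.sq_x
  sq_z i := by
    rw [signOp_mul_mul_signOp_mul, CharTwo.add_self_eq_zero, signOp_zero, h.sq_z, one_mul]
  comm_xx := h.comm_xx
  comm_zz i j := by
    rw [signOp_mul_mul_signOp_mul, signOp_mul_mul_signOp_mul, add_comm, h.comm_zz]
  comm_xz i j hij := by
    rw [← mul_assoc, ← signOp_comm, mul_assoc, h.comm_xz i j hij, mul_assoc]
  anticomm i := by
    rw [← mul_assoc, ← signOp_comm, mul_assoc, h.anticomm i, mul_assoc, mul_neg]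

/-- Dual families of binary vectors yield virtual Pauli operators; on each virtual qubit either the
`X`-type or the `Z`-type operator may play the role of `Z̄`. -/
theorem isVirtualPauliFamily_of_dual {N : ℕ} {σ : Type} (x z : σ → BVec N)
    (h1 : ∀ i, x i ⬝ᵥ z i = 1) (h0 : ∀ i j, i ≠ j → x i ⬝ᵥ z j = 0) (swap : σ → Bool) :
    IsVirtualPauliFamily (fun i => if swap i then pauliZ (z i) else pauliX (x i))
      (fun i => if swap i then pauliX (x i) else pauliZ (z i)) := by
  have hne : ∀ i j, i ≠ j → pauliX (x i) * pauliZ (z j) = pauliZ (z j) * pauliX (x i) := by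
    intro i j hij
    rw [pauliX_mul_pauliZ, h0 i j hij, signOp_zero, one_mul]
  have heq : ∀ i, pauliX (x i) * pauliZ (z i) = -(pauliZ (z i) * pauliX (x i)) := by
    intro i
    rw [pauliX_mul_pauliZ, h1, signOp_one, neg_one_mul]
  have hcomm : ∀ (b b' : Bool) (i j : σ), i ≠ j →
      (if b then pauliZ (z i) else pauliX (x i)) * (if b' then pauliZ (z j) else pauliX (x j)) =
      (if b' then pauliZ (z j) else pauliX (x j)) * (if b then pauliZ (z i) else pauliX (x i)) := by
    intro b b' i j hij
    cases b <;> cases b' <;> simp only [Bool.false_eq_true, if_true, if_false]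
    · exact pauliX_comm _ _
    · exact hne i j hij
    · exact (hne j i hij.symm).symm
    · exact pauliZ_comm _ _
  have hnot : ∀ i, (if swap i then pauliX (x i) else pauliZ (z i)) =
      if !swap i then pauliZ (z i) else pauliX (x i) := by
    intro i
    cases swap i <;> rfl
  constructor
  · intro i
    split
    exacts [pauliZ_mem_pauliGroup _, pauliX_mem_pauliGroup _]
  · intro i
    split
    exacts [pauliX_mem_pauliGroup _, pauliZ_mem_pauliGroup _]
  · intro i
    split
    exacts [pauliZ_mul_self _, pauliX_mul_self _]
  · intro i
    split
    exacts [pauliX_mul_self _, pauliZ_mul_self _]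
  · intro i j
    by_cases hij : i = j
    · rw [hij]
    · exact hcomm _ _ i j hij
  · intro i j
    by_cases hij : i = j
    · rw [hij]
    · simp only [hnot]
      exact hcomm _ _ i j hij
  · intro i j hij
    simp only [hnot]
    exact hcomm _ _ i j hij
  · intro i
    split
    · rw [heq, neg_neg]
    · exact heq i

/-- The parameters of a code, with the virtual qubits labelled by arbitrary finite types. -/
theorem HybridSubsystemCode.hasParameters_of_fintype {N : ℕ} (Q : HybridSubsystemCode N)
    {K M R S : Type} [Fintype K] [Fintype M] [Fintype R] [Fintype S]
    (hN : Fintype.card K + Fintype.card M + Fintype.card R + Fintype.card S = N)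
    (Xb Zb : K ⊕ M ⊕ R ⊕ S → (QOp N)ˣ) (φ : Q.Message ≃ (M → ZMod 2))
    (hvirt : IsVirtualPauliFamily Xb Zb)
    (hstab : ∀ b, Q.stab b = Subgroup.closure
      ((Set.range fun j : M => signOp N (φ b j) * Zb (.inr (.inl j))) ∪
        (Set.range fun i : S => Zb (.inr (.inr (.inr i))))))
    (hgauge : ∀ b, Q.gauge b = Subgroup.closure
      ({iOp N} ∪
        (Set.range fun j : M => Zb (.inr (.inl j))) ∪
        (Set.range fun g : R => Xb (.inr (.inr (.inl g)))) ∪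
        (Set.range fun g : R => Zb (.inr (.inr (.inl g)))) ∪
        (Set.range fun i : S => Zb (.inr (.inr (.inr i)))))) :
    Q.HasParameters (Fintype.card K) (Fintype.card M) (Fintype.card R) := by
  let eK := (Fintype.equivFin K).symm
  let eM := (Fintype.equivFin M).symm
  let eR := (Fintype.equivFin R).symm
  let eS := (Fintype.equivFin S).symm
  let e := Equiv.sumCongr eK (Equiv.sumCongr eM (Equiv.sumCongr eR eS))
  refine ⟨Fintype.card S, hN, Xb ∘ e, Zb ∘ e, φ.trans (Equiv.arrowCongr eM.symm (Equiv.refl _)),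
    hvirt.comp e.injective, ?_, ?_⟩
  · intro b
    rw [hstab, ← eM.surjective.range_comp, ← eS.surjective.range_comp]
    rfl
  · intro b
    rw [hgauge, ← eM.surjective.range_comp, ← eS.surjective.range_comp,
      ← eR.surjective.range_comp, ← eR.surjective.range_comp]
    rfl

/-! ### Dual families of binary vectors -/

section Dual

variable {N : ℕ}

theorem sum_smul_dotProduct {ι : Type*} [Fintype ι] (c : ι → ZMod 2) (x : ι → BVec N)
    (w : BVec N) : (∑ i, c i • x i) ⬝ᵥ w = ∑ i, c i * (x i ⬝ᵥ w) := by
  simp [sum_dotProduct, smul_dotProduct]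

theorem dotProduct_sum_smul {ι : Type*} [Fintype ι] (c : ι → ZMod 2) (x : ι → BVec N)
    (w : BVec N) : w ⬝ᵥ (∑ i, c i • x i) = ∑ i, c i * (w ⬝ᵥ x i) := by
  simp [dotProduct_sum, dotProduct_smul]

theorem dotProduct_eq_zero_of_mem_span {s : Set (BVec N)} {w u : BVec N}
    (h : ∀ v ∈ s, v ⬝ᵥ w = 0) (hu : u ∈ Submodule.span (ZMod 2) s) : u ⬝ᵥ w = 0 := by
  induction hu using Submodule.span_induction with
  | mem x hx => exact h x hx
  | zero => exact zero_dotProduct w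
  | add x y _ _ hx hy => rw [add_dotProduct, hx, hy, add_zero]
  | smul a x _ hx => rw [smul_dotProduct, hx, smul_zero]

theorem linearIndependent_of_dual {ι : Type*} [Fintype ι] [DecidableEq ι] {x z : ι → BVec N}
    (h : ∀ i j, x i ⬝ᵥ z j = if i = j then 1 else 0) : LinearIndependent (ZMod 2) x := by
  rw [Fintype.linearIndependent_iff]
  intro c hc j
  have := congrArg (· ⬝ᵥ z j) hc
  simpa [sum_smul_dotProduct, h] using this

theorem disjoint_span_of_dual {ι κ : Type*} [Fintype ι] [DecidableEq ι] {x z : ι → BVec N}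
    (h : ∀ i j, x i ⬝ᵥ z j = if i = j then 1 else 0) {y : κ → BVec N}
    (hy : ∀ a j, y a ⬝ᵥ z j = 0) :
    Disjoint (Submodule.span (ZMod 2) (Set.range x)) (Submodule.span (ZMod 2) (Set.range y)) := by
  rw [Submodule.disjoint_def]
  intro u hx hu
  obtain ⟨c, rfl⟩ := (Submodule.mem_span_range_iff_exists_fun (ZMod 2)).mp hx
  have hc : ∀ j, c j = 0 := by
    intro j
    have := dotProduct_eq_zero_of_mem_span (w := z j) (by rintro _ ⟨a, rfl⟩; exact hy a j) hu
    simpa [sum_smul_dotProduct, h] using this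
  simp [hc]

/-- The products with linearly independent vectors can be prescribed. -/
theorem exists_dotProduct_eq {ι : Type*} {v : ι → BVec N} (hv : LinearIndependent (ZMod 2) v)
    (c : ι → ZMod 2) : ∃ w : BVec N, ∀ i, v i ⬝ᵥ w = c i := by
  obtain ⟨f, hf⟩ : ∃ f : BVec N →ₗ[ZMod 2] ZMod 2, ∀ i, f (v i) = c i := by
    obtain ⟨f, hf⟩ := LinearMap.exists_extend ((Module.Basis.span hv).constr (ZMod 2) c)
    refine ⟨f, fun i => ?_⟩
    have := LinearMap.congr_fun hf (Module.Basis.span hv i)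
    rw [Module.Basis.constr_basis] at this
    rw [← this]
    simp [Module.Basis.span_apply]
  refine ⟨fun k => f fun j => if k = j then 1 else 0, fun i => ?_⟩
  rw [← hf i, LinearMap.pi_apply_eq_sum_univ f (v i)]
  rfl

/-- Linearly independent vectors orthogonal to the `z`-part of a pair of dual families have dual
vectors orthogonal to its `x`-part. -/
theorem exists_dual_extension {P A : Type*} [Fintype P] [DecidableEq P] [DecidableEq A]
    {x z : P → BVec N} (h : ∀ i j, x i ⬝ᵥ z j = if i = j then 1 else 0) {y : A → BVec N}
    (hy : ∀ a j, y a ⬝ᵥ z j = 0) (hind : LinearIndependent (ZMod 2) y) :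
    ∃ y' : A → BVec N, (∀ i a, x i ⬝ᵥ y' a = 0) ∧
      ∀ a b, y a ⬝ᵥ y' b = if a = b then 1 else 0 := by
  have hsum : LinearIndependent (ZMod 2) (Sum.elim x y) :=
    (linearIndependent_of_dual h).sum_type hind (disjoint_span_of_dual h hy)
  choose y' hy' using fun b : A =>
    exists_dotProduct_eq hsum (Sum.elim (fun _ => 0) fun a => if a = b then 1 else 0)
  exact ⟨y', fun i a => hy' a (.inl i), fun a b => hy' b (.inr a)⟩

/-- If only `0` in `T` is orthogonal to all `y i`, and `T` has as many dimensions as there are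
vectors `y i`, then `T` has a basis dual to them. -/
theorem exists_dual_basis {ι : Type*} [Fintype ι] [DecidableEq ι]
    (T : Submodule (ZMod 2) (BVec N)) (y : ι → BVec N)
    (hT : Module.finrank (ZMod 2) T = Fintype.card ι)
    (hinj : ∀ u ∈ T, (∀ i, u ⬝ᵥ y i = 0) → u = 0) :
    ∃ τ : ι → BVec N, (∀ i j, τ i ⬝ᵥ y j = if i = j then 1 else 0) ∧
      Submodule.span (ZMod 2) (Set.range τ) = T := by
  let f : T →ₗ[ZMod 2] (ι → ZMod 2) :=
    { toFun := fun u i => (u : BVec N) ⬝ᵥ y i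
      map_add' := fun u v => by ext i; simp [add_dotProduct]
      map_smul' := fun a u => by ext i; simp [smul_dotProduct] }
  have hf : Function.Injective f := by
    rw [injective_iff_map_eq_zero]
    intro u hu
    exact Subtype.ext (hinj u u.2 fun i => congrFun hu i)
  have hs : Function.Surjective f :=
    (LinearMap.injective_iff_surjective_of_finrank_eq_finrank (by simp [hT])).mp hf
  choose τ hτ using fun i => hs (Pi.single i 1)
  have hdual : ∀ i j, (τ i : BVec N) ⬝ᵥ y j = if i = j then 1 else 0 := by
    intro i j
    have := congrFun (hτ i) j
    simpa [f, Pi.single_apply, eq_comm] using this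
  refine ⟨fun i => τ i, hdual, ?_⟩
  apply Submodule.eq_of_le_of_finrank_eq
  · rw [Submodule.span_le]
    rintro _ ⟨i, rfl⟩
    exact (τ i).2
  · rw [finrank_span_eq_card (linearIndependent_of_dual hdual), hT]

end Dual

/-! ### Dual codes -/

section DualCode

variable {n : ℕ}

theorem mem_dualCode {C : Submodule (ZMod 2) (BVec n)} {w : BVec n} :
    w ∈ dualCode C ↔ ∀ c ∈ C, c ⬝ᵥ w = 0 := Iff.rfl

theorem dualCode_anti {C D : Submodule (ZMod 2) (BVec n)} (h : C ≤ D) : dualCode D ≤ dualCode C :=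
  fun _ hw c hc => hw c (h hc)

theorem dualCode_eq_orthogonal (C : Submodule (ZMod 2) (BVec n)) :
    dualCode C = LinearMap.BilinForm.orthogonal (dotProductBilin (ZMod 2) (ZMod 2)) C := rfl

theorem nondegenerate_dotProductBilin :
    LinearMap.BilinForm.Nondegenerate
      (dotProductBilin (ZMod 2) (ZMod 2) : LinearMap.BilinForm (ZMod 2) (BVec n)) := by
  constructor
  · intro v hv
    exact dotProduct_eq_zero v hv
  · intro v hv
    refine dotProduct_eq_zero v fun w => ?_
    rw [dotProduct_comm]
    exact hv w

theorem finrank_dualCode (C : Submodule (ZMod 2) (BVec n)) :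
    Module.finrank (ZMod 2) (dualCode C) = n - Module.finrank (ZMod 2) C := by
  rw [dualCode_eq_orthogonal,
    LinearMap.BilinForm.finrank_orthogonal nondegenerate_dotProductBilin]
  simp

/-- If `a + b` vectors suffice to span a sum of dimension `a + b`, where the second summand has
dimension `b`, then the first summand has dimension `a` and the sum is direct. -/
theorem finrank_and_disjoint_of_sup {a b : ℕ} {v : Fin a → BVec n}
    {U W : Submodule (ZMod 2) (BVec n)}
    (hsup : Submodule.span (ZMod 2) (Set.range v) ⊔ U = W)
    (hU : Module.finrank (ZMod 2) U = b) (hW : Module.finrank (ZMod 2) W = a + b) :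
    Module.finrank (ZMod 2) (Submodule.span (ZMod 2) (Set.range v)) = a ∧
      Disjoint (Submodule.span (ZMod 2) (Set.range v)) U := by
  have h1 := finrank_range_le_card (R := ZMod 2) v
  rw [Fintype.card_fin, Set.finrank] at h1
  have h2 := Submodule.finrank_sup_add_finrank_inf_eq (Submodule.span (ZMod 2) (Set.range v)) U
  rw [hsup] at h2
  refine ⟨by omega, ?_⟩
  rw [disjoint_iff, ← Submodule.finrank_eq_zero (R := ZMod 2)]
  omega

theorem finrank_le_length (E : Submodule (ZMod 2) (BVec n)) : Module.finrank (ZMod 2) E ≤ n := by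
  simpa using Submodule.finrank_le E

end DualCode

/-! ### Coefficient vectors -/

section CoeffVec

variable {n : ℕ}

theorem coeffVec_sub (f g : (ZMod 2)[X]) : coeffVec n (f - g) = coeffVec n f - coeffVec n g := by
  funext i
  simp [coeffVec]

/-- Vectors of polynomials of distinct degrees below `n` are linearly independent. -/
theorem linearIndependent_coeffVec {ι : Type*} [Fintype ι] (f : ι → (ZMod 2)[X])
    (h0 : ∀ i, f i ≠ 0) (hlt : ∀ i, (f i).natDegree < n)
    (hinj : Function.Injective fun i => (f i).natDegree) :
    LinearIndependent (ZMod 2) fun i => coeffVec n (f i) := by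
  classical
  rw [Fintype.linearIndependent_iff]
  intro c hc
  by_contra! hne
  obtain ⟨i₀, hi₀⟩ := hne
  obtain ⟨i, hi, hmax⟩ := Finset.exists_max_image (Finset.univ.filter fun i => c i ≠ 0)
    (fun i => (f i).natDegree) ⟨i₀, by simpa using hi₀⟩
  have := congrFun hc ⟨(f i).natDegree, hlt i⟩
  rw [Finset.sum_apply, Finset.sum_eq_single i] at this
  · simp only [Pi.smul_apply, coeffVec, coeff_natDegree, smul_eq_mul, Pi.zero_apply] at this
    rcases mul_eq_zero.mp this with h | h
    · exact (Finset.mem_filter.mp hi).2 h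
    · exact h0 i (leadingCoeff_eq_zero.mp h)
  · intro j _ hj
    by_cases hcj : c j = 0
    · simp [hcj]
    · have hle := hmax j (by simpa using hcj)
      have hlt' : (f j).natDegree < (f i).natDegree := lt_of_le_of_ne hle fun h => hj (hinj h)
      simp [coeffVec, coeff_eq_zero_of_natDegree_lt hlt']
  · simp

end CoeffVec

/-! ### Cyclic shifts -/

section Shift

variable {n : ℕ} [NeZero n]

theorem val_ofNat_emod (k : ℤ) : (((Fin.ofNat n (k % (n : ℤ)).toNat : Fin n) : ℕ) : ℤ) = k % n := by
  have hn : (0 : ℤ) < n := by exact_mod_cast Nat.pos_of_ne_zero (NeZero.ne n)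
  have h0 := Int.emod_nonneg k hn.ne'
  have h1 := Int.emod_lt_of_pos k hn
  rw [Fin.val_ofNat, Nat.mod_eq_of_lt (by omega), Int.toNat_of_nonneg h0]

theorem cyclicEntry_congr (c : BVec n) {k k' : ℤ} (h : k % n = k' % n) :
    cyclicEntry c k = cyclicEntry c k' := by
  rw [cyclicEntry, cyclicEntry, h]

theorem cyclicEntry_add_self (c : BVec n) (k : ℤ) : cyclicEntry c (k + n) = cyclicEntry c k :=
  cyclicEntry_congr c (by simp)

theorem cyclicEntry_eq (c : BVec n) {k : ℤ} (i : Fin n) (h : k % n = i) :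
    cyclicEntry c k = c i := by
  rw [cyclicEntry]
  congr 1
  ext
  have := val_ofNat_emod (n := n) k
  omega

@[simp] theorem cyclicEntry_val (c : BVec n) (i : Fin n) : cyclicEntry c (i : ℤ) = c i :=
  cyclicEntry_eq c i (Int.emod_eq_of_lt (by omega) (by omega))

theorem cyclicEntry_cyclicShift (c : BVec n) (α k : ℤ) :
    cyclicEntry (cyclicShift c α) k = cyclicEntry c (k - α) := by
  change cyclicEntry c ((((Fin.ofNat n (k % (n : ℤ)).toNat : Fin n) : ℕ) : ℤ) - α) = _
  rw [val_ofNat_emod]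
  exact cyclicEntry_congr c (by simp)

theorem cyclicShift_cyclicShift (c : BVec n) (α β : ℤ) :
    cyclicShift (cyclicShift c α) β = cyclicShift c (α + β) := by
  funext i
  change cyclicEntry (cyclicShift c α) _ = cyclicEntry c _
  rw [cyclicEntry_cyclicShift]
  congr 1
  ring

@[simp] theorem cyclicShift_zero (c : BVec n) : cyclicShift c 0 = c := by
  funext i
  simp [cyclicShift]

theorem cyclicShift_add (c d : BVec n) (α : ℤ) :
    cyclicShift (c + d) α = cyclicShift c α + cyclicShift d α := rfl

theorem cyclicShift_sum_smul {ι : Type*} [Fintype ι] (b : ι → ZMod 2) (c : ι → BVec n) (α : ℤ) :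
    cyclicShift (∑ i, b i • c i) α = ∑ i, b i • cyclicShift (c i) α := by
  funext i
  simp [cyclicShift, cyclicEntry, Finset.sum_apply]

theorem cyclicShift_dotProduct_cyclicShift (c d : BVec n) (α : ℤ) :
    cyclicShift c α ⬝ᵥ cyclicShift d α = c ⬝ᵥ d := by
  have hinj : Function.Injective fun i : Fin n =>
      (Fin.ofNat n (((i : ℤ) - α) % (n : ℤ)).toNat : Fin n) := by
    intro i j hij
    have h := congrArg (fun m : Fin n => ((m : ℕ) : ℤ)) hij
    simp only [val_ofNat_emod] at h
    have h' : (i : ℤ) % n = (j : ℤ) % n := by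
      simpa [Int.ModEq] using Int.ModEq.add_right α (show (i : ℤ) - α ≡ j - α [ZMOD n] from h)
    rw [Int.emod_eq_of_lt (by omega) (by omega), Int.emod_eq_of_lt (by omega) (by omega)] at h'
    ext
    exact_mod_cast h'
  exact (Finite.injective_iff_bijective.mp hinj).sum_comp fun i => c i * d i

theorem genVec_zero (f : (ZMod 2)[X]) : genVec n f 0 = coeffVec n f := by
  rw [genVec, Nat.cast_zero, cyclicShift_zero]

theorem cyclicShift_genVec (f : (ZMod 2)[X]) (i j : ℕ) :
    cyclicShift (genVec n f i) j = genVec n f (i + j) := by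
  rw [genVec, cyclicShift_cyclicShift, genVec, Nat.cast_add]

/-- A cyclic shift by one position is the multiplication by `x` modulo `x^n - 1`. -/
theorem cyclicShift_coeffVec (f : (ZMod 2)[X]) :
    cyclicShift (coeffVec n f) 1 = coeffVec n (X * f - C (f.coeff (n - 1)) * (X ^ n - 1)) := by
  funext i
  have hi := i.2
  have hn : (i : ℕ) ≠ n := i.2.ne
  change cyclicEntry (coeffVec n f) _ = Polynomial.coeff _ _
  rw [coeff_sub, coeff_C_mul, coeff_sub, coeff_X_pow, if_neg hn, coeff_one]
  obtain h0 | ⟨j, hj⟩ : (i : ℕ) = 0 ∨ ∃ j, (i : ℕ) = j + 1 := by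
    cases h : (i : ℕ) with
    | zero => exact .inl rfl
    | succ j => exact .inr ⟨j, rfl⟩
  · rw [cyclicEntry_eq _ ⟨n - 1, by omega⟩]
    · simp [h0, coeffVec]
    · rw [h0]
      have h1 : ((0 : ℕ) : ℤ) - 1 = ((n - 1 : ℕ) : ℤ) + n * (-1) := by omega
      rw [h1, Int.add_mul_emod_self_left]
      exact Int.emod_eq_of_lt (by omega) (by omega)
  · rw [cyclicEntry_eq _ ⟨j, by omega⟩]
    · simp [hj, coeffVec, coeff_X_mul]
    · rw [hj]
      push_cast
      rw [add_sub_cancel_right]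
      exact Int.emod_eq_of_lt (by omega) (by omega)

theorem genVec_eq_coeffVec {f : (ZMod 2)[X]} {i : ℕ} (h : f.natDegree + i < n) :
    genVec n f i = coeffVec n (X ^ i * f) := by
  induction i with
  | zero => rw [genVec_zero, pow_zero, one_mul]
  | succ i ih =>
    have h1 := cyclicShift_genVec (n := n) f i 1
    rw [Nat.cast_one] at h1
    rw [← h1, ih (by omega), cyclicShift_coeffVec]
    rw [coeff_eq_zero_of_natDegree_lt, C_0, zero_mul, sub_zero, pow_succ', mul_assoc]
    exact natDegree_mul_le.trans_lt (by rw [natDegree_X_pow]; omega)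

/-- The shift that moves the leading coefficient of a monic polynomial from the position `n - 1` to
the position `0`. -/
theorem genVec_eq_coeffVec_sub {f : (ZMod 2)[X]} (hf : f.Monic) {k : ℕ}
    (h : f.natDegree + (k + 1) = n) :
    genVec n f (k + 1) = coeffVec n (X ^ (k + 1) * f - (X ^ n - 1)) := by
  have h1 := cyclicShift_genVec (n := n) f k 1
  rw [Nat.cast_one] at h1
  rw [← h1, genVec_eq_coeffVec (by omega), cyclicShift_coeffVec]
  have hc : (X ^ k * f).coeff (n - 1) = 1 := by
    have : n - 1 = f.natDegree + k := by omega
    rw [this, coeff_X_pow_mul, hf.coeff_natDegree]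
  rw [hc, C_1, one_mul, pow_succ', mul_assoc]

/-- The vector of `f g` is the combination of the shifts of `g` with the coefficients of `f`. -/
theorem coeffVec_mul {f g : (ZMod 2)[X]} {k : ℕ} (hf : f.natDegree < k) (h : g.natDegree + k ≤ n) :
    coeffVec n (f * g) = ∑ i : Fin k, f.coeff i • genVec n g i := by
  have hsum : f * g = ∑ i : Fin k, C (f.coeff i) * (X ^ (i : ℕ) * g) := by
    conv_lhs => rw [f.as_sum_range' k hf]
    rw [Finset.sum_mul, ← Fin.sum_univ_eq_sum_range (fun i => monomial i (f.coeff i) * g) k]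
    simp [← C_mul_X_pow_eq_monomial, mul_assoc]
  funext m
  rw [Finset.sum_apply]
  change (f * g).coeff m = _
  rw [hsum, finsetSum_coeff]
  refine Finset.sum_congr rfl fun i _ => ?_
  rw [coeff_C_mul, genVec_eq_coeffVec (by omega)]
  rfl

theorem exists_coeffVec_eq (c : BVec n) :
    ∃ f : (ZMod 2)[X], f.natDegree < n ∧ coeffVec n f = c := by
  refine ⟨∑ i : Fin n, monomial (i : ℕ) (c i), ?_, ?_⟩
  · have hn : n ≠ 0 := NeZero.ne n
    refine lt_of_le_of_lt (natDegree_sum_le_of_forall_le (n := n - 1) _ _ fun i _ => ?_) (by omega)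
    exact (natDegree_monomial_le _).trans (by omega)
  · funext j
    simp [coeffVec, coeff_monomial, Fin.val_inj]

end Shift

/-! ### Generators of cyclic codes and of their duals -/

section Cyclic

variable {n : ℕ} [NeZero n]

theorem genVec_mem {E : Submodule (ZMod 2) (BVec n)} (hE : IsCyclicCode E) {f : (ZMod 2)[X]}
    (hf : coeffVec n f ∈ E) (i : ℕ) : genVec n f i ∈ E :=
  hE _ hf _

/-- A code word is a multiple of the generator polynomial: the remainder would be a code word of
smaller degree. -/
theorem IsGeneratorPolynomial.dvd {E : Submodule (ZMod 2) (BVec n)} {g : (ZMod 2)[X]}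
    (hg : IsGeneratorPolynomial E g) (hE : IsCyclicCode E) {f : (ZMod 2)[X]} (hf : f.natDegree < n)
    (hfE : coeffVec n f ∈ E) : g ∣ f := by
  have hlt := hg.natDegree_lt
  rw [← modByMonic_eq_zero_iff_dvd hg.monic]
  by_contra hne
  have h2 : (f %ₘ g).natDegree < g.natDegree :=
    natDegree_lt_natDegree hne (degree_modByMonic_lt f hg.monic)
  have hq : (f /ₘ g).natDegree < n - g.natDegree := by
    rw [natDegree_divByMonic f hg.monic]
    omega
  have hmem : coeffVec n (f %ₘ g) ∈ E := by
    rw [modByMonic_eq_sub_mul_div, coeffVec_sub, mul_comm g, coeffVec_mul hq (by omega)]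
    exact E.sub_mem hfE (E.sum_mem fun i _ => E.smul_mem _ (genVec_mem hE hg.mem _))
  have h1 := hg.minimal _ hne (by omega) hmem
  omega

theorem span_genVec_of_finrank {E : Submodule (ZMod 2) (BVec n)} {ι : Type*} [Fintype ι]
    (f : ι → (ZMod 2)[X]) (s : ι → ℕ) (h0 : ∀ i, f i ≠ 0)
    (hlt : ∀ i, (f i).natDegree + s i < n)
    (hinj : Function.Injective fun i => (f i).natDegree + s i)
    (hmem : ∀ i, genVec n (f i) (s i) ∈ E)
    (hcard : Fintype.card ι = Module.finrank (ZMod 2) E) :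
    Submodule.span (ZMod 2) (Set.range fun i => genVec n (f i) (s i)) = E := by
  have hdeg : ∀ i, (X ^ s i * f i).natDegree = (f i).natDegree + s i := by
    intro i
    rw [natDegree_mul (pow_ne_zero _ X_ne_zero) (h0 i), natDegree_X_pow, add_comm]
  have hvec : (fun i => genVec n (f i) (s i)) = fun i => coeffVec n (X ^ s i * f i) := by
    funext i
    exact genVec_eq_coeffVec (hlt i)
  have hind : LinearIndependent (ZMod 2) fun i => genVec n (f i) (s i) := by
    rw [hvec]
    apply linearIndependent_coeffVec
    · exact fun i => mul_ne_zero (pow_ne_zero _ X_ne_zero) (h0 i)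
    · intro i
      rw [hdeg]
      exact hlt i
    · simpa only [hdeg] using hinj
  apply Submodule.eq_of_le_of_finrank_eq
  · rw [Submodule.span_le]
    rintro _ ⟨i, rfl⟩
    exact hmem i
  · rw [finrank_span_eq_card hind, hcard]

/-- The dimension of a cyclic code is the codegree of its generator polynomial. -/
theorem IsGeneratorPolynomial.natDegree_add_finrank {E : Submodule (ZMod 2) (BVec n)}
    {g : (ZMod 2)[X]} (hg : IsGeneratorPolynomial E g) (hE : IsCyclicCode E) :
    g.natDegree + Module.finrank (ZMod 2) E = n := by
  have hlt := hg.natDegree_lt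
  have hspan : Submodule.span (ZMod 2)
      (Set.range fun i : Fin (n - g.natDegree) => genVec n g i) = E := by
    apply le_antisymm
    · rw [Submodule.span_le]
      rintro _ ⟨i, rfl⟩
      exact genVec_mem hE hg.mem _
    · intro c hc
      obtain ⟨f, hf, rfl⟩ := exists_coeffVec_eq c
      obtain ⟨a, rfl⟩ := hg.dvd hE hf hc
      by_cases ha : a = 0
      · subst ha
        have : coeffVec n (g * 0) = 0 := by
          funext i
          simp [coeffVec]
        rw [this]
        exact Submodule.zero_mem _
      · rw [natDegree_mul hg.monic.ne_zero ha] at hf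
        rw [mul_comm, coeffVec_mul (k := n - g.natDegree) (by omega) (by omega)]
        exact Submodule.sum_mem _ fun i _ =>
          Submodule.smul_mem _ _ (Submodule.subset_span ⟨i, rfl⟩)
  have hind : LinearIndependent (ZMod 2) fun i : Fin (n - g.natDegree) => genVec n g i := by
    have hdeg : ∀ i : ℕ, (X ^ i * g).natDegree = i + g.natDegree := by
      intro i
      rw [natDegree_mul (pow_ne_zero _ X_ne_zero) hg.monic.ne_zero, natDegree_X_pow]
    have hvec : (fun i : Fin (n - g.natDegree) => genVec n g i) =
        fun i : Fin (n - g.natDegree) => coeffVec n (X ^ (i : ℕ) * g) := by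
      funext i
      exact genVec_eq_coeffVec (by omega)
    rw [hvec]
    apply linearIndependent_coeffVec
    · exact fun i => mul_ne_zero (pow_ne_zero _ X_ne_zero) hg.monic.ne_zero
    · intro i
      rw [hdeg]
      omega
    · intro i j hij
      simp only [hdeg] at hij
      ext
      omega
  have := finrank_span_eq_card hind
  rw [hspan, Fintype.card_fin] at this
  omega

theorem IsGeneratorPolynomial.dvd_X_pow_sub_one {E : Submodule (ZMod 2) (BVec n)}
    {g : (ZMod 2)[X]} (hg : IsGeneratorPolynomial E g) (hE : IsCyclicCode E) :
    g ∣ X ^ n - 1 := by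
  have hlt := hg.natDegree_lt
  obtain ⟨k, hk⟩ : ∃ k, g.natDegree + (k + 1) = n := ⟨n - g.natDegree - 1, by omega⟩
  have hmem := genVec_mem hE hg.mem (k + 1)
  rw [genVec_eq_coeffVec_sub hg.monic hk] at hmem
  have hmonic : (X ^ (k + 1) * g).Monic := (monic_X_pow _).mul hg.monic
  have hdeg : (X ^ (k + 1) * g).natDegree = n := by
    rw [(monic_X_pow _).natDegree_mul hg.monic, natDegree_X_pow]
    omega
  have hn : n ≠ 0 := NeZero.ne n
  have hmonic' : (X ^ n - 1 : (ZMod 2)[X]).Monic := monic_X_pow_sub_C 1 hn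
  have hdeg' : (X ^ n - 1 : (ZMod 2)[X]).natDegree = n := natDegree_X_pow_sub_C
  have hsmall : (X ^ (k + 1) * g - (X ^ n - 1)).natDegree < n := by
    by_cases h0 : X ^ (k + 1) * g - (X ^ n - 1) = 0
    · rw [h0, natDegree_zero]
      omega
    · refine (natDegree_lt_natDegree h0 ?_).trans_eq hdeg
      apply degree_sub_lt_left _ hmonic.ne_zero
        (hmonic.leadingCoeff.trans hmonic'.leadingCoeff.symm)
      rw [degree_eq_natDegree hmonic.ne_zero, degree_eq_natDegree hmonic'.ne_zero, hdeg, hdeg']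
  have := hg.dvd hE hsmall hmem
  exact (dvd_sub_right (dvd_mul_left g _)).mp this

/-- A generator polynomial times its check polynomial. -/
theorem IsGeneratorPolynomial.mul_divByMonic {E : Submodule (ZMod 2) (BVec n)}
    {g : (ZMod 2)[X]} (hg : IsGeneratorPolynomial E g) (hE : IsCyclicCode E) :
    g * ((X ^ n - 1) /ₘ g) = X ^ n - 1 := by
  have h := modByMonic_add_div (X ^ n - 1) g
  rwa [(modByMonic_eq_zero_iff_dvd hg.monic).mpr (hg.dvd_X_pow_sub_one hE), zero_add] at h

theorem IsGeneratorPolynomial.natDegree_divByMonic {E : Submodule (ZMod 2) (BVec n)}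
    {g : (ZMod 2)[X]} (hg : IsGeneratorPolynomial E g) (hE : IsCyclicCode E) :
    ((X ^ n - 1) /ₘ g).natDegree = Module.finrank (ZMod 2) E := by
  have h := hg.natDegree_add_finrank hE
  rw [Polynomial.natDegree_divByMonic _ hg.monic]
  have : (X ^ n - 1 : (ZMod 2)[X]).natDegree = n := natDegree_X_pow_sub_C
  omega

theorem IsGeneratorPolynomial.coeff_zero_divByMonic {E : Submodule (ZMod 2) (BVec n)}
    {g : (ZMod 2)[X]} (hg : IsGeneratorPolynomial E g) (hE : IsCyclicCode E) :
    ((X ^ n - 1) /ₘ g).coeff 0 ≠ 0 := by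
  intro h0
  have h := congrArg (fun f => f.coeff 0) (hg.mul_divByMonic hE)
  have hn : n ≠ 0 := NeZero.ne n
  simp [mul_coeff_zero, h0, hn.symm] at h

theorem IsGeneratorPolynomial.natDegree_reversedCheck {E : Submodule (ZMod 2) (BVec n)}
    {g : (ZMod 2)[X]} (hg : IsGeneratorPolynomial E g) (hE : IsCyclicCode E) :
    (reversedCheck n g).natDegree = Module.finrank (ZMod 2) E := by
  rw [reversedCheck, reverse_natDegree, hg.natDegree_divByMonic hE,
    natTrailingDegree_eq_zero.mpr (.inr (hg.coeff_zero_divByMonic hE)), Nat.sub_zero]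

theorem IsGeneratorPolynomial.reversedCheck_ne_zero {E : Submodule (ZMod 2) (BVec n)}
    {g : (ZMod 2)[X]} (hg : IsGeneratorPolynomial E g) (hE : IsCyclicCode E) :
    reversedCheck n g ≠ 0 := by
  rw [reversedCheck, Ne, reverse_eq_zero]
  intro h
  exact hg.coeff_zero_divByMonic hE (by rw [h, coeff_zero])

/-- The shifts of the generator polynomial form a basis of a cyclic code. -/
theorem IsGeneratorPolynomial.span_genVec {E : Submodule (ZMod 2) (BVec n)} {g : (ZMod 2)[X]}
    (hg : IsGeneratorPolynomial E g) (hE : IsCyclicCode E) :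
    Submodule.span (ZMod 2)
      (Set.range fun i : Fin (Module.finrank (ZMod 2) E) => genVec n g i) = E := by
  have hdeg := hg.natDegree_add_finrank hE
  exact span_genVec_of_finrank (fun _ : Fin _ => g) (fun i => (i : ℕ)) (fun _ => hg.monic.ne_zero)
    (fun i => by omega) (fun i j hij => by ext; dsimp only at hij; omega)
    (fun i => genVec_mem hE hg.mem _) (by rw [Fintype.card_fin])

/-- The product of a shift of `g` and a shift of the reversed check polynomial is a coefficient of
`x^n - 1`, and one other than the first and the last. -/
theorem IsGeneratorPolynomial.genVec_reversedCheck_mem {E : Submodule (ZMod 2) (BVec n)}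
    {g : (ZMod 2)[X]} (hg : IsGeneratorPolynomial E g) (hE : IsCyclicCode E) {j : ℕ}
    (hj : j < n - Module.finrank (ZMod 2) E) : genVec n (reversedCheck n g) j ∈ dualCode E := by
  have hdeg := hg.natDegree_add_finrank hE
  have hdegr := hg.natDegree_reversedCheck hE
  have hdegh := hg.natDegree_divByMonic hE
  have hmul := hg.mul_divByMonic hE
  set k := Module.finrank (ZMod 2) E with hk
  set h := (X ^ n - 1) /ₘ g with hh
  have hspan := hg.span_genVec hE
  rw [mem_dualCode]
  intro c hc
  rw [← hspan] at hc
  refine dotProduct_eq_zero_of_mem_span ?_ hc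
  rintro _ ⟨i, rfl⟩
  have hi := i.2
  have hrev : ∀ m, (X ^ j * reversedCheck n g).coeff m =
      if m ≤ k + j then h.coeff (k + j - m) else 0 := by
    intro m
    rw [coeff_X_pow_mul', reversedCheck, ← hh]
    by_cases hjm : j ≤ m
    · rw [if_pos hjm]
      by_cases hm : m ≤ k + j
      · rw [if_pos hm, coeff_reverse, hdegh, revAt_le (by omega)]
        congr 1
        omega
      · rw [if_neg hm]
        exact coeff_eq_zero_of_natDegree_lt ((reverse_natDegree_le h).trans_lt (by omega))
    · rw [if_neg hjm, if_pos (by omega), coeff_eq_zero_of_natDegree_lt (by omega)]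
  have hcoeff : (X ^ (i : ℕ) * g * h).coeff (k + j) = 0 := by
    rw [mul_assoc, hmul, coeff_X_pow_mul', if_pos (by omega), coeff_sub, coeff_X_pow, coeff_one,
      if_neg (by omega), if_neg (by omega), sub_zero]
  dsimp only
  rw [genVec_eq_coeffVec (by omega), genVec_eq_coeffVec (by omega), ← hcoeff, coeff_mul,
    Finset.Nat.sum_antidiagonal_eq_sum_range_succ_mk]
  change ∑ m : Fin n, (X ^ (i : ℕ) * g).coeff m * (X ^ j * reversedCheck n g).coeff m = _
  refine (Fin.sum_univ_eq_sum_range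
    (fun m : ℕ => (X ^ (i : ℕ) * g).coeff m * (X ^ j * reversedCheck n g).coeff m) n).trans ?_
  symm
  apply Finset.sum_subset_zero_on_sdiff
  · intro m hm
    simp only [Finset.mem_range] at hm ⊢
    omega
  · intro m hm
    simp only [Finset.mem_sdiff, Finset.mem_range] at hm
    rw [hrev, if_neg (by omega), mul_zero]
  · intro m hm
    rw [Finset.mem_range] at hm
    rw [hrev, if_pos (by omega)]

/-- A cyclic code that contains a second code is the sum of this code and of the span of the first
shifts of its generator: the degrees of these shifts fill the gap between the two generators. -/
theorem span_genVec_sup_of_finrank {E F : Submodule (ZMod 2) (BVec n)} {f g : (ZMod 2)[X]}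
    {a b : ℕ} (hf0 : f ≠ 0) (hg0 : g ≠ 0) (hf : f.natDegree + a = g.natDegree)
    (hg : g.natDegree + b = n) (hfF : ∀ i < a, genVec n f i ∈ F)
    (hgE : Submodule.span (ZMod 2) (Set.range fun i : Fin b => genVec n g i) = E) (hEF : E ≤ F)
    (hF : Module.finrank (ZMod 2) F = a + b) :
    Submodule.span (ZMod 2) (Set.range fun i : Fin a => genVec n f i) ⊔ E = F := by
  have h := span_genVec_of_finrank (n := n) (E := F) (ι := Fin a ⊕ Fin b)
    (Sum.elim (fun _ => f) fun _ => g) (Sum.elim (fun i => (i : ℕ)) fun i => (i : ℕ))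
    (by rintro (i | i) <;> simpa)
    (by rintro (i | i) <;> simp only [Sum.elim_inl, Sum.elim_inr] <;> omega)
    (by
      rintro (i | i) (j | j) hij <;> simp only [Sum.elim_inl, Sum.elim_inr] at hij
      · exact congrArg Sum.inl (Fin.ext (by omega))
      · omega
      · omega
      · exact congrArg Sum.inr (Fin.ext (by omega)))
    (by
      rintro (i | i)
      · exact hfF i i.2
      · exact hEF (hgE ▸ Submodule.subset_span ⟨i, rfl⟩))
    (by simp [hF])
  rw [← hgE, ← Submodule.span_union, ← h]
  congr 1
  ext v
  simp

/-- The shifts of the reversed check polynomial form a basis of the dual code. -/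
theorem IsGeneratorPolynomial.span_genVec_reversedCheck {E : Submodule (ZMod 2) (BVec n)}
    {g : (ZMod 2)[X]} (hg : IsGeneratorPolynomial E g) (hE : IsCyclicCode E) :
    Submodule.span (ZMod 2)
      (Set.range fun i : Fin (n - Module.finrank (ZMod 2) E) => genVec n (reversedCheck n g) i) =
      dualCode E := by
  have hdeg := hg.natDegree_reversedCheck hE
  exact span_genVec_of_finrank (fun _ : Fin _ => reversedCheck n g) (fun i => (i : ℕ))
    (fun _ => hg.reversedCheck_ne_zero hE) (fun i => by omega)
    (fun i j hij => by ext; dsimp only at hij; omega)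
    (fun i => hg.genVec_reversedCheck_mem hE i.2) (by rw [Fintype.card_fin, finrank_dualCode])

variable {C D : Submodule (ZMod 2) (BVec n)} {p q : (ZMod 2)[X]}

theorem span_generator_sup (hC : IsCyclicCode C) (hD : IsCyclicCode D) (hCD : C ≤ D)
    (hp : IsGeneratorPolynomial C p) (hq : IsGeneratorPolynomial D q) :
    Submodule.span (ZMod 2) (Set.range fun m : Fin
      (Module.finrank (ZMod 2) D - Module.finrank (ZMod 2) C) => genVec n q m) ⊔ C = D := by
  have h1 := hp.natDegree_add_finrank hC
  have h2 := hq.natDegree_add_finrank hD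
  have h3 := Submodule.finrank_mono hCD
  exact span_genVec_sup_of_finrank hq.monic.ne_zero hp.monic.ne_zero (by omega) h1
    (fun i _ => genVec_mem hD hq.mem i) (hp.span_genVec hC) hCD (by omega)

theorem span_reversedCheck_sup (hC : IsCyclicCode C) (hD : IsCyclicCode D) (hCD : C ≤ D)
    (hp : IsGeneratorPolynomial C p) (hq : IsGeneratorPolynomial D q) :
    Submodule.span (ZMod 2) (Set.range fun j : Fin
      (Module.finrank (ZMod 2) D - Module.finrank (ZMod 2) C) => genVec n (reversedCheck n p) j) ⊔
      dualCode D = dualCode C := by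
  have h1 := hp.natDegree_reversedCheck hC
  have h2 := hq.natDegree_reversedCheck hD
  have h3 := Submodule.finrank_mono hCD
  have h4 := finrank_le_length D
  exact span_genVec_sup_of_finrank (b := n - Module.finrank (ZMod 2) D)
    (hp.reversedCheck_ne_zero hC) (hq.reversedCheck_ne_zero hD) (by omega) (by omega)
    (fun i hi => hp.genVec_reversedCheck_mem hC (by omega)) (hq.span_genVec_reversedCheck hD)
    (dualCode_anti hCD) (by rw [finrank_dualCode]; omega)

theorem span_generator_sup_dualCode (hC : IsCyclicCode C) (hCC : dualCode C ≤ C)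
    (hp : IsGeneratorPolynomial C p) :
    Submodule.span (ZMod 2) (Set.range fun l : Fin
      (2 * Module.finrank (ZMod 2) C - n) => genVec n p l) ⊔ dualCode C = C := by
  have h1 := hp.natDegree_reversedCheck hC
  have h2 := hp.natDegree_add_finrank hC
  have h3 := Submodule.finrank_mono hCC
  rw [finrank_dualCode] at h3
  have h4 := finrank_le_length C
  exact span_genVec_sup_of_finrank hp.monic.ne_zero (hp.reversedCheck_ne_zero hC)
    (b := n - Module.finrank (ZMod 2) C) (by omega) (by omega)
    (fun i _ => genVec_mem hC hp.mem i) (hp.span_genVec_reversedCheck hC) hCC (by omega)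

end Cyclic

/-! ### Nested cyclic codes and paired generators -/

/-- The hypotheses on the two classical codes: cyclic codes `C ⊂ D` of dimensions `kc` and `kd` with
generator polynomials `p` and `q`, where `C` properly contains its dual. -/
structure IsNestedPair {n : ℕ} [NeZero n] (C D : Submodule (ZMod 2) (BVec n)) (kc kd : ℕ)
    (p q : (ZMod 2)[X]) : Prop where
  cyclic_C : IsCyclicCode C
  cyclic_D : IsCyclicCode D
  dual_lt : dualCode C < C
  lt : C < D
  finrank_C : Module.finrank (ZMod 2) C = kc
  finrank_D : Module.finrank (ZMod 2) D = kd
  gen_C : IsGeneratorPolynomial C p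
  gen_D : IsGeneratorPolynomial D q

namespace IsNestedPair

variable {n : ℕ} [NeZero n] {C D : Submodule (ZMod 2) (BVec n)} {kc kd : ℕ} {p q : (ZMod 2)[X]}

theorem kc_lt_kd (h : IsNestedPair C D kc kd p q) : kc < kd := by
  have := Submodule.finrank_lt_finrank_of_lt h.lt
  rwa [h.finrank_C, h.finrank_D] at this

theorem kd_le (h : IsNestedPair C D kc kd p q) : kd ≤ n :=
  h.finrank_D ▸ finrank_le_length D

theorem lt_two_mul (h : IsNestedPair C D kc kd p q) : n < 2 * kc := by
  have := Submodule.finrank_lt_finrank_of_lt h.dual_lt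
  rw [finrank_dualCode, h.finrank_C] at this
  omega

theorem dual_D_le (h : IsNestedPair C D kc kd p q) : dualCode D ≤ D :=
  (dualCode_anti h.lt.le).trans (h.dual_lt.le.trans h.lt.le)

theorem span_p_sup (h : IsNestedPair C D kc kd p q) :
    Submodule.span (ZMod 2) (Set.range fun l : Fin (2 * kc - n) => genVec n p l) ⊔ dualCode C =
      C := by
  have := span_generator_sup_dualCode h.cyclic_C h.dual_lt.le h.gen_C
  rwa [h.finrank_C] at this

theorem span_q_sup (h : IsNestedPair C D kc kd p q) :
    Submodule.span (ZMod 2) (Set.range fun m : Fin (kd - kc) => genVec n q m) ⊔ C = D := by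
  have := span_generator_sup h.cyclic_C h.cyclic_D h.lt.le h.gen_C h.gen_D
  rwa [h.finrank_C, h.finrank_D] at this

theorem span_pt_sup (h : IsNestedPair C D kc kd p q) :
    Submodule.span (ZMod 2)
      (Set.range fun j : Fin (kd - kc) => genVec n (reversedCheck n p) j) ⊔ dualCode D =
      dualCode C := by
  have := span_reversedCheck_sup h.cyclic_C h.cyclic_D h.lt.le h.gen_C h.gen_D
  rwa [h.finrank_C, h.finrank_D] at this

theorem span_qt (h : IsNestedPair C D kc kd p q) :
    Submodule.span (ZMod 2) (Set.range fun i : Fin (n - kd) => genVec n (reversedCheck n q) i) =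
      dualCode D := by
  have := h.gen_D.span_genVec_reversedCheck h.cyclic_D
  rwa [h.finrank_D] at this

theorem genVec_q_mem (h : IsNestedPair C D kc kd p q) (m : ℕ) : genVec n q m ∈ D :=
  genVec_mem h.cyclic_D h.gen_D.mem m

theorem genVec_pt_mem (h : IsNestedPair C D kc kd p q) (j : Fin (kd - kc)) :
    genVec n (reversedCheck n p) j ∈ dualCode C :=
  h.span_pt_sup.le (Submodule.mem_sup_left (Submodule.subset_span ⟨j, rfl⟩))

theorem genVec_qt_mem (h : IsNestedPair C D kc kd p q) (i : Fin (n - kd)) :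
    genVec n (reversedCheck n q) i ∈ dualCode D :=
  h.span_qt.le (Submodule.subset_span ⟨i, rfl⟩)

/-- The form on the span of the first shifts of `p` is nondegenerate, as the dual code is the
radical of the form on `C`. -/
theorem exists_dual_p (h : IsNestedPair C D kc kd p q) :
    ∃ sz : Fin (2 * kc - n) → BVec n,
      (∀ l l' : Fin (2 * kc - n), genVec n p l ⬝ᵥ sz l' = if l = l' then 1 else 0) ∧
      Submodule.span (ZMod 2) (Set.range sz) =
        Submodule.span (ZMod 2) (Set.range fun l : Fin (2 * kc - n) => genVec n p l) := by
  have h1 := h.lt_two_mul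
  have h2 := h.kc_lt_kd
  have h3 := h.kd_le
  obtain ⟨hfin, hdisj⟩ := finrank_and_disjoint_of_sup h.span_p_sup
    (finrank_dualCode C) (by rw [h.finrank_C]; omega)
  obtain ⟨sz, hsz, hspan⟩ := exists_dual_basis
    (Submodule.span (ZMod 2) (Set.range fun l : Fin (2 * kc - n) => genVec n p l))
    (fun l : Fin (2 * kc - n) => genVec n p l) (by rw [hfin, Fintype.card_fin]) (by
      intro u hu horth
      refine Submodule.disjoint_def.mp hdisj u hu ?_
      have huC : u ∈ C := h.span_p_sup ▸ Submodule.mem_sup_left hu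
      rw [mem_dualCode]
      intro c hc
      obtain ⟨a, ha, b, hb, rfl⟩ := Submodule.mem_sup.mp (h.span_p_sup.ge hc)
      rw [add_dotProduct, dotProduct_comm b, hb u huC, add_zero]
      refine dotProduct_eq_zero_of_mem_span ?_ ha
      rintro _ ⟨l, rfl⟩
      rw [dotProduct_comm]
      exact horth l)
  refine ⟨sz, fun l l' => ?_, hspan⟩
  rw [dotProduct_comm, hsz]
  simp [eq_comm]

/-- The pairing of the first shifts of the reversed check polynomial of `C` with the first shifts of
`q` is perfect, since it is the pairing of `C^⊥ / D^⊥` with `D / C`. -/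
theorem exists_dual_q (h : IsNestedPair C D kc kd p q) :
    ∃ τ : Fin (kd - kc) → BVec n,
      (∀ j m : Fin (kd - kc), τ j ⬝ᵥ genVec n q m = if j = m then 1 else 0) ∧
      Submodule.span (ZMod 2) (Set.range τ) =
        Submodule.span (ZMod 2)
          (Set.range fun j : Fin (kd - kc) => genVec n (reversedCheck n p) j) := by
  have h2 := h.kc_lt_kd
  have h3 := h.kd_le
  obtain ⟨hfin, hdisj⟩ := finrank_and_disjoint_of_sup h.span_pt_sup (finrank_dualCode D)
    (by rw [finrank_dualCode, h.finrank_C, h.finrank_D]; omega)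
  refine exists_dual_basis _ (fun m : Fin (kd - kc) => genVec n q m)
    (by rw [hfin, Fintype.card_fin]) ?_
  intro u hu horth
  refine Submodule.disjoint_def.mp hdisj u hu ?_
  have huC : u ∈ dualCode C := h.span_pt_sup ▸ Submodule.mem_sup_left hu
  rw [mem_dualCode]
  intro c hc
  obtain ⟨a, ha, b, hb, rfl⟩ := Submodule.mem_sup.mp (h.span_q_sup.ge hc)
  rw [add_dotProduct, huC b hb, add_zero]
  refine dotProduct_eq_zero_of_mem_span ?_ ha
  rintro _ ⟨m, rfl⟩
  rw [dotProduct_comm]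
  exact horth m

end IsNestedPair

section QPrime

variable {n : ℕ} {k t : ℕ} {sx sz : Fin k → BVec n}

/-- Subtracting the component in `⟨s^z_l⟩` makes a vector orthogonal to `⟨s^x_l⟩`. -/
theorem dotProduct_add_projection_eq_zero
    (hs : ∀ l l', sx l ⬝ᵥ sz l' = if l = l' then 1 else 0) (v : BVec n) {u : BVec n}
    (hu : u ∈ Submodule.span (ZMod 2) (Set.range sx)) :
    u ⬝ᵥ (v + ∑ l, (v ⬝ᵥ sx l) • sz l) = 0 := by
  refine dotProduct_eq_zero_of_mem_span ?_ hu
  rintro _ ⟨l, rfl⟩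
  rw [dotProduct_add, dotProduct_sum_smul]
  simp [hs, dotProduct_comm v, CharTwo.add_self_eq_zero]

variable {q' τ : Fin t → BVec n}

/-- Adding a suitable combination of isotropic dual vectors makes two copies of a family orthogonal
to each other. -/
theorem dotProduct_add_sum_eq_zero (hτ : ∀ j m, τ j ⬝ᵥ q' m = if j = m then 1 else 0)
    (i j : Fin t) : q' i ⬝ᵥ (q' j + ∑ k, (q' j ⬝ᵥ q' k) • τ k) = 0 := by
  rw [dotProduct_add, dotProduct_sum_smul]
  simp [dotProduct_comm _ (τ _), hτ, dotProduct_comm (q' j) (q' i), CharTwo.add_self_eq_zero]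

theorem span_union_add_sum (u : Fin t → Fin t → ZMod 2) :
    Submodule.span (ZMod 2) (Set.range τ ∪ Set.range fun j => q' j + ∑ k, u j k • τ k) =
      Submodule.span (ZMod 2) (Set.range τ ∪ Set.range q') := by
  have hsum : ∀ (s : Set (BVec n)) (j : Fin t),
      ∑ k, u j k • τ k ∈ Submodule.span (ZMod 2) (Set.range τ ∪ s) := fun s j =>
    Submodule.sum_mem _ fun k _ =>
      Submodule.smul_mem _ _ (Submodule.subset_span (.inl ⟨k, rfl⟩))
  apply le_antisymm <;> rw [Submodule.span_le] <;> rintro _ (⟨j, rfl⟩ | ⟨j, rfl⟩)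
  · exact Submodule.subset_span (.inl ⟨j, rfl⟩)
  · exact Submodule.add_mem _ (Submodule.subset_span (.inr ⟨j, rfl⟩)) (hsum _ j)
  · exact Submodule.subset_span (.inl ⟨j, rfl⟩)
  · have h := Submodule.sub_mem _ (Submodule.subset_span (R := ZMod 2)
      (s := Set.range τ ∪ Set.range fun j => q' j + ∑ k, u j k • τ k) (.inr ⟨j, rfl⟩)) (hsum _ j)
    rwa [add_sub_cancel_right] at h

end QPrime

namespace IsNestedPair

variable {n : ℕ} [NeZero n] {C D : Submodule (ZMod 2) (BVec n)} {kc kd : ℕ} {p q : (ZMod 2)[X]}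

theorem nonempty_pairedGenerators (h : IsNestedPair C D kc kd p q) :
    Nonempty (PairedGenerators n kc kd p q) := by
  obtain ⟨sz, hs, hsz⟩ := h.exists_dual_p
  obtain ⟨τ, hτq, hspan⟩ := h.exists_dual_q
  let q' : Fin (kd - kc) → BVec n := fun m =>
    genVec n q m + ∑ l : Fin (2 * kc - n), (genVec n q m ⬝ᵥ genVec n p l) • sz l
  have hSC : Submodule.span (ZMod 2) (Set.range fun l : Fin (2 * kc - n) => genVec n p l) ≤ C :=
    le_sup_left.trans_eq h.span_p_sup
  have hszC : ∀ l, sz l ∈ C := fun l => hSC (hsz ▸ Submodule.subset_span ⟨l, rfl⟩)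
  have hτC : ∀ j, τ j ∈ dualCode C := fun j =>
    h.span_pt_sup ▸ Submodule.mem_sup_left (hspan ▸ Submodule.subset_span ⟨j, rfl⟩)
  have hCτ : ∀ c ∈ C, ∀ j, τ j ⬝ᵥ c = 0 := by
    intro c hc j
    rw [dotProduct_comm]
    exact hτC j c hc
  have hττ : ∀ i j, τ i ⬝ᵥ τ j = 0 := fun i j => hCτ _ (h.dual_lt.le (hτC j)) i
  have hτq' : ∀ j m, τ j ⬝ᵥ q' m = if j = m then 1 else 0 := by
    intro j m
    rw [dotProduct_add, hτq, dotProduct_sum_smul]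
    simp [hCτ _ (hszC _)]
  have hq'S : ∀ u ∈ Submodule.span (ZMod 2)
      (Set.range fun l : Fin (2 * kc - n) => genVec n p l), ∀ m, u ⬝ᵥ q' m = 0 :=
    fun u hu m => dotProduct_add_projection_eq_zero hs _ hu
  have hSτ : ∀ u ∈ C, ∀ (c : Fin (kd - kc) → ZMod 2), u ⬝ᵥ ∑ k, c k • τ k = 0 := by
    intro u hu c
    rw [dotProduct_sum_smul]
    exact Finset.sum_eq_zero fun k _ => by rw [hτC k u hu, mul_zero]
  have hsp : Submodule.span (ZMod 2) (Set.range τ ∪ Set.range q') = Submodule.span (ZMod 2)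
      ((Set.range fun j : Fin (kd - kc) => genVec n (reversedCheck n p) j) ∪ Set.range q') := by
    rw [Submodule.span_union, hspan, Submodule.span_union]
  exact ⟨{
    sx := fun l => genVec n p l
    sz := sz
    tt := τ
    tx := q'
    tz := fun j => q' j + ∑ k, (q' j ⬝ᵥ q' k) • τ k
    span_sx := rfl
    span_sz := hsz
    span_tt := hspan
    span_tx := hsp
    span_tz := (span_union_add_sum _).trans hsp
    sx_sz := hs
    tt_tx := hτq'
    tt_tz := fun j m => by
      rw [dotProduct_add, hτq', dotProduct_sum_smul]
      simp [hττ]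
    sx_tz := fun l j => by
      rw [dotProduct_add, hq'S _ (Submodule.subset_span ⟨l, rfl⟩),
        hSτ _ (hSC (Submodule.subset_span ⟨l, rfl⟩)), add_zero]
    sz_tx := fun l j => hq'S _ (hsz ▸ Submodule.subset_span ⟨l, rfl⟩) j
    tx_tz := dotProduct_add_sum_eq_zero hτq' }⟩

end IsNestedPair

/-! ### Vectors on the main block and the ancilla positions -/

/-- The vector of the `Z Z` operator that the ancilla qubit with the number `i` contributes. -/
def ancillaVec (n al ar i : ℕ) : BVec (n + al + ar) :=
  fun x => if (x : ℕ) = i ∨ (x : ℕ) = i + n then 1 else 0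

/-- The position, outside the main block, of the ancilla qubit with the number `i`. -/
def ancillaPos (n al i : ℕ) : ℕ := if i < al then i else i + n

/-- The indicator vector of the position of an ancilla qubit. -/
def ancillaUnit (n al ar i : ℕ) : BVec (n + al + ar) :=
  fun x => if (x : ℕ) = ancillaPos n al i then 1 else 0

theorem ancillaUnit_dotProduct {n al ar i : ℕ} (hi : i < al + ar) (u : BVec (n + al + ar)) :
    ancillaUnit n al ar i ⬝ᵥ u =
      u ⟨ancillaPos n al i, by unfold ancillaPos; split <;> omega⟩ := by
  have : ancillaUnit n al ar i = Pi.single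
      (⟨ancillaPos n al i, by unfold ancillaPos; split <;> omega⟩ : Fin (n + al + ar)) 1 := by
    funext x
    simp [ancillaUnit, Pi.single_apply, Fin.ext_iff]
  rw [this, single_dotProduct, one_mul]

theorem ancillaUnit_dotProduct_ancillaVec {n al ar i j : ℕ} (hle : al + ar ≤ n) (hi : i < al + ar)
    (hj : j < al + ar) :
    ancillaUnit n al ar i ⬝ᵥ ancillaVec n al ar j = if i = j then 1 else 0 := by
  rw [ancillaUnit_dotProduct hi]
  change (if ancillaPos n al i = j ∨ ancillaPos n al i = j + n then _ else _) = _
  congr 1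
  unfold ancillaPos
  split <;> apply propext <;> omega

section Placement

variable {n : ℕ} [NeZero n]

/-- The linear map `u ↦ (last al bits of u | u | first ar bits of u)`. -/
def extMap (n : ℕ) [NeZero n] (al ar : ℕ) : BVec n →ₗ[ZMod 2] BVec (n + al + ar) where
  toFun := cyclicExtension al ar
  map_add' _ _ := rfl
  map_smul' _ _ := rfl

/-- The linear map that places a vector on the positions `s, …, s + n - 1`. -/
def placeMap (n : ℕ) [NeZero n] (al ar s : ℕ) : BVec n →ₗ[ZMod 2] BVec (n + al + ar) where
  toFun := placeAt al ar s
  map_add' u v := by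
    funext i
    simp only [placeAt, Pi.add_apply]
    split
    · rfl
    · rw [add_zero]
  map_smul' a u := by
    funext i
    simp only [placeAt, Pi.smul_apply]
    split
    · rfl
    · rw [smul_zero]

theorem extMap_dotProduct_placeMap (al ar : ℕ) (u v : BVec n) :
    extMap n al ar u ⬝ᵥ placeMap n al ar al v = u ⬝ᵥ v := by
  let g : Fin n → Fin (n + al + ar) := fun k => ⟨al + k, by omega⟩
  symm
  refine Finset.sum_of_injOn g (fun i _ j _ hij => ?_) (fun _ _ => Finset.mem_univ _)
    (fun i _ hi => ?_) (fun k _ => ?_)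
  · have := congrArg Fin.val hij
    simp only [g] at this
    ext
    omega
  · have hout : ¬(al ≤ (i : ℕ) ∧ (i : ℕ) < al + n) := by
      intro h
      exact hi ⟨⟨i - al, by omega⟩, Finset.mem_coe.mpr (Finset.mem_univ _), Fin.ext (by
        simp only [g]
        omega)⟩
    change _ * (if al ≤ (i : ℕ) ∧ (i : ℕ) < al + n then _ else 0) = 0
    rw [if_neg hout, mul_zero]
  · change u k * v k = cyclicEntry u (((al + k : ℕ) : ℤ) - al) *
      (if al ≤ al + (k : ℕ) ∧ al + (k : ℕ) < al + n then
        cyclicEntry v (((al + k : ℕ) : ℤ) - al) else 0)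
    have hk : ((al + k : ℕ) : ℤ) - al = (k : ℕ) := by omega
    rw [if_pos (by omega), hk, cyclicEntry_val, cyclicEntry_val]

theorem extMap_injective (al ar : ℕ) : Function.Injective (extMap n al ar) := by
  rw [injective_iff_map_eq_zero]
  intro u hu
  refine dotProduct_eq_zero u fun v => ?_
  rw [← extMap_dotProduct_placeMap al ar u v, hu, zero_dotProduct]

theorem placeMap_injective (al ar : ℕ) : Function.Injective (placeMap n al ar al) := by
  rw [injective_iff_map_eq_zero]
  intro u hu
  refine dotProduct_eq_zero u fun v => ?_
  rw [dotProduct_comm, ← extMap_dotProduct_placeMap al ar v u, hu, dotProduct_zero]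

theorem ancillaVec_eq_add {al ar i : ℕ} (hi : i < al + ar) :
    ancillaVec n al ar i =
      Pi.single (⟨i, by omega⟩ : Fin (n + al + ar)) 1 +
        Pi.single (⟨i + n, by omega⟩ : Fin (n + al + ar)) 1 := by
  have hn : n ≠ 0 := NeZero.ne n
  funext x
  simp only [ancillaVec, Pi.add_apply, Pi.single_apply, Fin.ext_iff]
  by_cases h1 : (x : ℕ) = i
  · have h2 : (x : ℕ) ≠ i + n := by omega
    simp [h1, hn]
  · simp [h1]

/-- Extended vectors have equal entries at the distance `n`. -/
theorem extMap_dotProduct_ancillaVec {al ar i : ℕ} (hi : i < al + ar) (u : BVec n) :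
    extMap n al ar u ⬝ᵥ ancillaVec n al ar i = 0 := by
  rw [ancillaVec_eq_add hi, dotProduct_add, dotProduct_single, dotProduct_single, mul_one, mul_one]
  change cyclicEntry u ((i : ℤ) - al) + cyclicEntry u (((i + n : ℕ) : ℤ) - al) = 0
  have h : ((i + n : ℕ) : ℤ) - al = ((i : ℤ) - al) + n := by
    push_cast
    ring
  rw [h, cyclicEntry_add_self, CharTwo.add_self_eq_zero]

theorem ancillaUnit_dotProduct_placeMap {al ar i : ℕ} (hi : i < al + ar) (u : BVec n) :
    ancillaUnit n al ar i ⬝ᵥ placeMap n al ar al u = 0 := by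
  rw [ancillaUnit_dotProduct hi]
  change (if al ≤ ancillaPos n al i ∧ ancillaPos n al i < al + n then _ else 0) = _
  rw [if_neg]
  unfold ancillaPos
  split <;> omega

end Placement

/-! ### Virtual qubits -/

/-- Labels of the virtual qubits: the logical ones, those with `Z̄ = X̂(τ_j)`, those with
`Z̄ = Ẑ(τ_j)`, those of the ancilla qubits, and those with `Z̄ = X̂(q̃_i)` and with
`Z̄ = Ẑ(q̃_i)`. -/
inductive VirtualIndex (k t a d : ℕ) : Type
  | logical (l : Fin k) : VirtualIndex k t a d
  | xT (j : Fin t) : VirtualIndex k t a d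
  | zT (j : Fin t) : VirtualIndex k t a d
  | anc (i : Fin a) : VirtualIndex k t a d
  | xD (i : Fin d) : VirtualIndex k t a d
  | zD (i : Fin d) : VirtualIndex k t a d

namespace VirtualIndex

variable {k t a d : ℕ}

/-- The labels as a sum of the labels with both vectors known, those with only the `x`-vector known
and those with only the `z`-vector known. -/
def toSum : VirtualIndex k t a d → ((Fin k ⊕ Fin t ⊕ Fin t ⊕ Fin a) ⊕ Fin d) ⊕ Fin d
  | logical l => .inl (.inl (.inl l))
  | xT j => .inl (.inl (.inr (.inl j)))
  | zT j => .inl (.inl (.inr (.inr (.inl j))))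
  | anc i => .inl (.inl (.inr (.inr (.inr i))))
  | xD i => .inl (.inr i)
  | zD i => .inr i

theorem toSum_injective : Function.Injective (toSum (k := k) (t := t) (a := a) (d := d)) := by
  intro i j hij
  cases i <;> cases j <;> simp_all [toSum]

/-- Whether `Z̄` is the `X`-type operator. -/
def swapped : VirtualIndex k t a d → Bool
  | xT _ => true
  | xD _ => true
  | _ => false

/-- The signs of the operators `Z̄`, with the sign `(-1)^{e j}` for `Ẑ(τ_j)`. -/
def signOf (e : Fin t → ZMod 2) : VirtualIndex k t a d → ZMod 2
  | zT j => e j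
  | _ => 0

end VirtualIndex

/-- A pair of dual families, together with isotropic independent vectors orthogonal to the
`x`-vectors and others orthogonal to the `z`-vectors, extends to a larger pair of dual families. -/
theorem exists_dual_completion {N : ℕ} {P A B : Type} [Fintype P] [DecidableEq P] [Fintype A]
    [DecidableEq A] [DecidableEq B] {x z : P → BVec N} {y : A → BVec N} {y' : B → BVec N}
    (h : ∀ i j, x i ⬝ᵥ z j = if i = j then 1 else 0)
    (hy : ∀ a j, y a ⬝ᵥ z j = 0) (hy' : ∀ i b, x i ⬝ᵥ y' b = 0) (hyy : ∀ a b, y a ⬝ᵥ y' b = 0)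
    (hind : LinearIndependent (ZMod 2) y) (hind' : LinearIndependent (ZMod 2) y') :
    ∃ X Z : (P ⊕ A) ⊕ B → BVec N, (∀ i j, X i ⬝ᵥ Z j = if i = j then 1 else 0) ∧
      (∀ i, X (.inl (.inl i)) = x i) ∧ (∀ i, Z (.inl (.inl i)) = z i) ∧
      (∀ a, X (.inl (.inr a)) = y a) ∧ (∀ b, Z (.inr b) = y' b) := by
  obtain ⟨zA, hxzA, hyzA⟩ := exists_dual_extension h hy hind
  have hdual : ∀ i j : P ⊕ A,
      Sum.elim x y i ⬝ᵥ Sum.elim z zA j = if i = j then 1 else 0 := by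
    rintro (i | i) (j | j) <;> simp [h, hy, hxzA, hyzA]
  obtain ⟨xB, hzxB, hyxB⟩ := exists_dual_extension (x := Sum.elim z zA) (z := Sum.elim x y)
    (y := y') (by
      intro i j
      rw [dotProduct_comm, hdual]
      simp [eq_comm]) (by
      rintro b (i | i)
      · rw [dotProduct_comm]
        exact hy' i b
      · rw [dotProduct_comm]
        exact hyy i b) hind'
  refine ⟨Sum.elim (Sum.elim x y) xB, Sum.elim (Sum.elim z zA) y', ?_, fun _ => rfl, fun _ => rfl,
    fun _ => rfl, fun _ => rfl⟩
  rintro (i | i) (j | j)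
  · simpa using hdual i j
  · rcases i with i | i
    · simpa using hy' i j
    · simpa using hyy i j
  · rw [dotProduct_comm]
    simpa using hzxB j i
  · rw [dotProduct_comm]
    simpa [eq_comm] using hyxB j i

/-- The vectors of the virtual Pauli operators: dual families `x` and `z`, built from a basis `τ` of
the span of the vectors `p̃_j` that is dual to the vectors `q_m`. The partner of `X̂(τ_j)` is
`q'_j` with a correction in the span of `τ`, which makes it orthogonal to the partners `q'_k` of the
operators `Ẑ(τ_k)`. -/
structure VirtualVectors {n : ℕ} [NeZero n] {kc kd : ℕ} {p q : (ZMod 2)[X]}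
    (V : PairedGenerators n kc kd p q) (al ar : ℕ) where
  τ : Fin (kd - kc) → BVec n
  x : VirtualIndex (2 * kc - n) (kd - kc) (al + ar) (n - kd) → BVec (n + al + ar)
  z : VirtualIndex (2 * kc - n) (kd - kc) (al + ar) (n - kd) → BVec (n + al + ar)
  dual_self : ∀ i, x i ⬝ᵥ z i = 1
  dual_ne : ∀ i j, i ≠ j → x i ⬝ᵥ z j = 0
  τ_q : ∀ j m : Fin (kd - kc), τ j ⬝ᵥ genVec n q m = if j = m then 1 else 0
  span_τ : Submodule.span (ZMod 2) (Set.range τ) = Submodule.span (ZMod 2)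
    (Set.range fun j : Fin (kd - kc) => genVec n (reversedCheck n p) j)
  x_xT : ∀ j, x (.xT j) = extMap n al ar (τ j)
  z_xT : ∀ j, z (.xT j) =
    placeMap n al ar al (V.qPrime j + ∑ k : Fin (kd - kc), (V.qPrime j ⬝ᵥ V.qPrime k) • τ k)
  x_zT : ∀ j, x (.zT j) = extMap n al ar (V.qPrime j)
  z_zT : ∀ j, z (.zT j) = placeMap n al ar al (τ j)
  z_anc : ∀ i, z (.anc i) = ancillaVec n al ar i
  x_xD : ∀ i, x (.xD i) = extMap n al ar (genVec n (reversedCheck n q) i)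
  z_zD : ∀ i, z (.zD i) = placeMap n al ar al (genVec n (reversedCheck n q) i)

namespace IsNestedPair

variable {n : ℕ} [NeZero n] {C D : Submodule (ZMod 2) (BVec n)} {kc kd : ℕ} {p q : (ZMod 2)[X]}

theorem linearIndependent_qt (h : IsNestedPair C D kc kd p q) :
    LinearIndependent (ZMod 2) fun i : Fin (n - kd) => genVec n (reversedCheck n q) i := by
  rw [linearIndependent_iff_card_eq_finrank_span, Set.finrank, h.span_qt, finrank_dualCode,
    h.finrank_D, Fintype.card_fin]

theorem nonempty_virtualVectors (h : IsNestedPair C D kc kd p q)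
    (V : PairedGenerators n kc kd p q) {al ar : ℕ} (hle : al + ar ≤ n) :
    Nonempty (VirtualVectors V al ar) := by
  obtain ⟨τ, hτq, hspan⟩ := h.exists_dual_q
  have hSC : Submodule.span (ZMod 2) (Set.range fun l : Fin (2 * kc - n) => genVec n p l) ≤ C :=
    le_sup_left.trans_eq h.span_p_sup
  have hsxC : ∀ l, V.sx l ∈ C := fun l => hSC (V.span_sx ▸ Submodule.subset_span ⟨l, rfl⟩)
  have hszC : ∀ l, V.sz l ∈ C := fun l => hSC (V.span_sz ▸ Submodule.subset_span ⟨l, rfl⟩)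
  have hτC : ∀ j, τ j ∈ dualCode C := fun j =>
    h.span_pt_sup ▸ Submodule.mem_sup_left (hspan ▸ Submodule.subset_span ⟨j, rfl⟩)
  have hCτ : ∀ c ∈ C, ∀ j, τ j ⬝ᵥ c = 0 := by
    intro c hc j
    rw [dotProduct_comm]
    exact hτC j c hc
  have hττ : ∀ i j, τ i ⬝ᵥ τ j = 0 := fun i j => hCτ _ (h.dual_lt.le (hτC j)) i
  have hτq' : ∀ j m : Fin (kd - kc), τ j ⬝ᵥ V.qPrime m = if j = m then 1 else 0 := by
    intro j m
    rw [PairedGenerators.qPrime, dotProduct_add, hτq, dotProduct_sum_smul]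
    simp [hCτ _ (hszC _)]
  have hq'sx : ∀ l m, V.sx l ⬝ᵥ V.qPrime m = 0 := fun l m =>
    dotProduct_add_projection_eq_zero V.sx_sz _ (Submodule.subset_span ⟨l, rfl⟩)
  have hq'sz : ∀ l m, V.sz l ⬝ᵥ V.qPrime m = 0 := fun l m =>
    dotProduct_add_projection_eq_zero V.sx_sz _
      ((V.span_sz.trans V.span_sx.symm).le (Submodule.subset_span ⟨l, rfl⟩))
  have hq'D : ∀ m, V.qPrime m ∈ D := fun m =>
    D.add_mem (h.genVec_q_mem m) (D.sum_mem fun l _ => D.smul_mem _ (h.lt.le (hszC l)))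
  have hτD : ∀ j, τ j ∈ D := fun j => h.lt.le (h.dual_lt.le (hτC j))
  let qz : Fin (kd - kc) → BVec n := fun j =>
    V.qPrime j + ∑ k : Fin (kd - kc), (V.qPrime j ⬝ᵥ V.qPrime k) • τ k
  have hqzD : ∀ j, qz j ∈ D := fun j =>
    D.add_mem (hq'D j) (D.sum_mem fun k _ => D.smul_mem _ (hτD k))
  have hsxqz : ∀ l j, V.sx l ⬝ᵥ qz j = 0 := by
    intro l j
    rw [dotProduct_add, hq'sx, dotProduct_sum_smul, zero_add]
    exact Finset.sum_eq_zero fun k _ => by rw [hτC k _ (hsxC l), mul_zero]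
  have hτqz : ∀ i j, τ i ⬝ᵥ qz j = if i = j then 1 else 0 := by
    intro i j
    rw [dotProduct_add, hτq', dotProduct_sum_smul]
    simp [hττ]
  have hq'qz : ∀ i j : Fin (kd - kc), V.qPrime i ⬝ᵥ qz j = 0 := dotProduct_add_sum_eq_zero hτq'
  have hDx : ∀ v ∈ D, ∀ i : Fin (n - kd), genVec n (reversedCheck n q) i ⬝ᵥ v = 0 := by
    intro v hv i
    rw [dotProduct_comm]
    exact h.genVec_qt_mem i v hv
  obtain ⟨X, Z, hXZ, hX, hZ, hXD, hZD⟩ := exists_dual_completion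
    (P := Fin (2 * kc - n) ⊕ Fin (kd - kc) ⊕ Fin (kd - kc) ⊕ Fin (al + ar))
    (A := Fin (n - kd)) (B := Fin (n - kd))
    (x := Sum.elim (fun l => extMap n al ar (V.sx l)) (Sum.elim (fun j => extMap n al ar (τ j))
      (Sum.elim (fun j : Fin (kd - kc) => extMap n al ar (V.qPrime j))
        fun i => ancillaUnit n al ar i)))
    (z := Sum.elim (fun l => placeMap n al ar al (V.sz l))
      (Sum.elim (fun j => placeMap n al ar al (qz j))
        (Sum.elim (fun j => placeMap n al ar al (τ j)) fun i => ancillaVec n al ar i)))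
    (y := fun i : Fin (n - kd) => extMap n al ar (genVec n (reversedCheck n q) i))
    (y' := fun i : Fin (n - kd) => placeMap n al ar al (genVec n (reversedCheck n q) i))
    (by
      rintro (i | i | i | i) (j | j | j | j) <;>
        simp [extMap_dotProduct_placeMap, extMap_dotProduct_ancillaVec,
          ancillaUnit_dotProduct_placeMap, ancillaUnit_dotProduct_ancillaVec hle, V.sx_sz, hsxqz,
          hCτ _ (hszC _), hττ, hτqz, hq'qz, dotProduct_comm _ (τ _), hCτ _ (hsxC _), hτq',
          dotProduct_comm (V.qPrime _) (V.sz _), hq'sz, Fin.ext_iff, eq_comm])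
    (by
      rintro i (j | j | j | j)
      · exact (extMap_dotProduct_placeMap _ _ _ _).trans (hDx _ (h.lt.le (hszC j)) i)
      · exact (extMap_dotProduct_placeMap _ _ _ _).trans (hDx _ (hqzD j) i)
      · exact (extMap_dotProduct_placeMap _ _ _ _).trans (hDx _ (hτD j) i)
      · exact extMap_dotProduct_ancillaVec j.2 _)
    (by
      rintro (j | j | j | j) i
      · exact (extMap_dotProduct_placeMap _ _ _ _).trans
          (h.genVec_qt_mem i _ (h.lt.le (hsxC j)))
      · exact (extMap_dotProduct_placeMap _ _ _ _).trans (h.genVec_qt_mem i _ (hτD j))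
      · exact (extMap_dotProduct_placeMap _ _ _ _).trans (h.genVec_qt_mem i _ (hq'D j))
      · exact ancillaUnit_dotProduct_placeMap j.2 _)
    (fun i j => (extMap_dotProduct_placeMap _ _ _ _).trans
      (hDx _ (h.dual_D_le (h.genVec_qt_mem j)) i))
    (h.linearIndependent_qt.map' _ (LinearMap.ker_eq_bot.mpr (extMap_injective al ar)))
    (h.linearIndependent_qt.map' _ (LinearMap.ker_eq_bot.mpr (placeMap_injective al ar)))
  exact ⟨{
    τ := τ
    x := X ∘ VirtualIndex.toSum
    z := Z ∘ VirtualIndex.toSum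
    dual_self := fun i => (hXZ _ _).trans (if_pos rfl)
    dual_ne := fun i j hij => (hXZ _ _).trans (if_neg (VirtualIndex.toSum_injective.ne hij))
    τ_q := hτq
    span_τ := hspan
    x_xT := fun j => hX (.inr (.inl j))
    z_xT := fun j => hZ (.inr (.inl j))
    x_zT := fun j => hX (.inr (.inr (.inl j)))
    z_zT := fun j => hZ (.inr (.inr (.inl j)))
    z_anc := fun i => hZ (.inr (.inr (.inr i)))
    x_xD := hXD
    z_zD := hZD }⟩

end IsNestedPair

/-! ### Parameters -/

theorem Subgroup.closure_le_closure_of_forall {G : Type*} [Group G] {A B : Set G}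
    (h : ∀ H : Subgroup G, B ⊆ H → A ⊆ H) : Subgroup.closure A ≤ Subgroup.closure B :=
  (Subgroup.closure_le _).mpr (h _ Subgroup.subset_closure)

section Parameters

variable {n : ℕ} [NeZero n] {C D : Submodule (ZMod 2) (BVec n)} {kc kd : ℕ} {p q : (ZMod 2)[X]}
  {V : PairedGenerators n kc kd p q} {al ar : ℕ}

namespace VirtualVectors

/-- The operators `X̄` of the virtual qubits. -/
def opX (W : VirtualVectors V al ar)
    (i : VirtualIndex (2 * kc - n) (kd - kc) (al + ar) (n - kd)) : (QOp (n + al + ar))ˣ :=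
  if i.swapped then pauliZ (W.z i) else pauliX (W.x i)

/-- The operators `Z̄` of the virtual qubits, with the sign `(-1)^{e j}` for `Ẑ(τ_j)`. -/
def opZ (W : VirtualVectors V al ar) (e : Fin (kd - kc) → ZMod 2)
    (i : VirtualIndex (2 * kc - n) (kd - kc) (al + ar) (n - kd)) : (QOp (n + al + ar))ˣ :=
  signOp _ (i.signOf e) * if i.swapped then pauliX (W.x i) else pauliZ (W.z i)

theorem isVirtualPauliFamily (W : VirtualVectors V al ar) (e : Fin (kd - kc) → ZMod 2) :
    IsVirtualPauliFamily W.opX (W.opZ e) :=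
  (isVirtualPauliFamily_of_dual W.x W.z W.dual_self W.dual_ne VirtualIndex.swapped).signed _

variable (W : VirtualVectors V al ar) (e : Fin (kd - kc) → ZMod 2)

theorem opX_xT (j : Fin (kd - kc)) : W.opX (.xT j) = pauliZ (placeMap n al ar al
    (V.qPrime j + ∑ k : Fin (kd - kc), (V.qPrime j ⬝ᵥ V.qPrime k) • W.τ k)) := by
  rw [← W.z_xT]
  rfl

theorem opX_zT (j : Fin (kd - kc)) :
    W.opX (.zT j) = pauliX (extMap n al ar (V.qPrime j)) := by
  rw [← W.x_zT]
  rfl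

theorem opZ_xT (j : Fin (kd - kc)) : W.opZ e (.xT j) = pauliX (extMap n al ar (W.τ j)) := by
  rw [← W.x_xT]
  exact (congrArg (· * _) (signOp_zero _)).trans (one_mul _)

theorem opZ_zT (j : Fin (kd - kc)) :
    W.opZ e (.zT j) = signOp _ (e j) * pauliZ (placeMap n al ar al (W.τ j)) := by
  rw [← W.z_zT]
  rfl

/-- The labels of the virtual qubits whose `Z̄` is a generator common to all types of codes. -/
def commonIndex {k t a d : ℕ} : Fin a ⊕ Fin d ⊕ Fin d → VirtualIndex k t a d :=
  Sum.elim .anc (Sum.elim .xD .zD)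

theorem commonIndex_injective {k t a d : ℕ} :
    Function.Injective (commonIndex (k := k) (t := t) (a := a) (d := d)) := by
  rintro (i | i | i) (j | j | j) ⟨⟩ <;> rfl

theorem range_opZ_commonIndex :
    (Set.range fun i => W.opZ e (commonIndex i)) = commonGenerators n kd q al ar := by
  have hanc : ∀ i, W.opZ e (.anc i) = pauliZ (ancillaVec n al ar i) := fun i => by
    rw [← W.z_anc]
    exact (congrArg (· * _) (signOp_zero _)).trans (one_mul _)
  have hxD : ∀ i, W.opZ e (.xD i) =
      pauliX (extMap n al ar (genVec n (reversedCheck n q) i)) := fun i => by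
    rw [← W.x_xD]
    exact (congrArg (· * _) (signOp_zero _)).trans (one_mul _)
  have hzD : ∀ i, W.opZ e (.zD i) =
      pauliZ (placeMap n al ar al (genVec n (reversedCheck n q) i)) := fun i => by
    rw [← W.z_zD]
    exact (congrArg (· * _) (signOp_zero _)).trans (one_mul _)
  rw [Sum.range_eq, Sum.range_eq (_ ∘ Sum.inr), Set.union_comm]
  refine congrArg₂ _ (congrArg₂ _ ?_ ?_) ?_
  · exact congrArg Set.range (funext hxD)
  · exact congrArg Set.range (funext hzD)
  · exact congrArg Set.range (funext hanc)

theorem closure_zGenerators (w : BVec n) :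
    Subgroup.closure (zGenerators n (kd - kc) p al ar w) = Subgroup.closure
      (Set.range fun j => signOp _ (W.τ j ⬝ᵥ w) * pauliZ (placeMap n al ar al (W.τ j))) :=
  (closure_range_eq_spanImage (signedZ (placeMap n al ar al) w) _).trans
    ((congrArg _ W.span_τ.symm).trans (closure_range_eq_spanImage _ _).symm)

theorem closure_xGenerators (v : BVec n) :
    Subgroup.closure (xGenerators n (kd - kc) p al ar v) = Subgroup.closure
      (Set.range fun j => signOp _ (W.τ j ⬝ᵥ v) * pauliX (extMap n al ar (W.τ j))) :=
  (closure_range_eq_spanImage (signedX (extMap n al ar) v) _).trans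
    ((congrArg _ W.span_τ.symm).trans (closure_range_eq_spanImage _ _).symm)

theorem τ_dotProduct_phaseX (b : BVec (kd - kc)) (j : Fin (kd - kc)) :
    W.τ j ⬝ᵥ phaseX n q b = b j := by
  rw [phaseX, dotProduct_sum_smul]
  simp [W.τ_q]

/-- The classical bits encoded by the phases of the `Z`-type generators, at the positions `pos m`
among the generators `Ẑ(τ_j)`; the other ones of these generators have the fixed signs given by
`e`. -/
structure IsZPhase {γ : ℕ} (w : BVec γ → BVec n) (pos : Fin γ → Fin (kd - kc)) : Prop where
  injective : Function.Injective pos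
  pos_eq : ∀ c m, W.τ (pos m) ⬝ᵥ w c = e (pos m) + c m
  of_notMem : ∀ c, ∀ j ∉ Set.range pos, W.τ j ⬝ᵥ w c = e j

variable {W e} {γ : ℕ} {w : BVec γ → BVec n} {pos : Fin γ → Fin (kd - kc)}

theorem IsZPhase.card_add (hw : W.IsZPhase e w pos) :
    γ + Fintype.card {j // j ∉ Set.range pos} = kd - kc := by
  classical
  have h1 := Fintype.card_subtype_compl (· ∈ Set.range pos)
  have h2 := Set.card_range_of_injective hw.injective
  have h3 := Fintype.card_le_of_injective pos hw.injective
  simp only [Fintype.card_fin] at h1 h2 h3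
  have h4 : Fintype.card {x // x ∈ Set.range pos} = γ := h2
  rw [h1, h4]
  omega

theorem IsZPhase.range_eq (hw : W.IsZPhase e w pos) (c : BVec γ) :
    (Set.range fun j => signOp (n + al + ar) (W.τ j ⬝ᵥ w c) *
      pauliZ (placeMap n al ar al (W.τ j))) =
    (Set.range fun m => signOp _ (c m) * W.opZ e (.zT (pos m))) ∪
      Set.range fun j : {j // j ∉ Set.range pos} => W.opZ e (.zT j) := by
  have hm : ∀ m, signOp _ (c m) * W.opZ e (.zT (pos m)) =
      signOp (n + al + ar) (W.τ (pos m) ⬝ᵥ w c) * pauliZ (placeMap n al ar al (W.τ (pos m))) := by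
    intro m
    rw [opZ_zT, ← mul_assoc, ← signOp_add, hw.pos_eq, add_comm (c m)]
  have hj : ∀ j : {j // j ∉ Set.range pos}, W.opZ e (.zT j) =
      signOp (n + al + ar) (W.τ j ⬝ᵥ w c) * pauliZ (placeMap n al ar al (W.τ j)) := by
    intro j
    rw [opZ_zT, hw.of_notMem c j j.2]
  simp only [hm, hj]
  ext g
  constructor
  · rintro ⟨j, rfl⟩
    by_cases hjp : j ∈ Set.range pos
    · obtain ⟨m, rfl⟩ := hjp
      exact .inl ⟨m, rfl⟩
    · exact .inr ⟨⟨j, hjp⟩, rfl⟩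
  · rintro (⟨m, rfl⟩ | ⟨j, rfl⟩)
    · exact ⟨pos m, rfl⟩
    · exact ⟨j, rfl⟩

theorem span_le_zPart {H : Subgroup (QOp (n + al + ar))ˣ}
    (hτ : ∀ j, pauliZ (placeMap n al ar al (W.τ j)) ∈ H) :
    Submodule.span (ZMod 2)
      (Set.range fun j : Fin (kd - kc) => genVec n (reversedCheck n p) j) ≤
      zPart H (placeMap n al ar al) := by
  rw [← W.span_τ, Submodule.span_le]
  rintro _ ⟨j, rfl⟩
  exact hτ j

theorem span_le_xPart {H : Subgroup (QOp (n + al + ar))ˣ}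
    (hτ : ∀ j, pauliX (extMap n al ar (W.τ j)) ∈ H) :
    Submodule.span (ZMod 2)
      (Set.range fun j : Fin (kd - kc) => genVec n (reversedCheck n p) j) ≤
      xPart H (extMap n al ar) := by
  rw [← W.span_τ, Submodule.span_le]
  rintro _ ⟨j, rfl⟩
  exact hτ j

theorem τ_mem {U : Submodule (ZMod 2) (BVec n)}
    (hU : ∀ j : Fin (kd - kc), genVec n (reversedCheck n p) j ∈ U) (j : Fin (kd - kc)) :
    W.τ j ∈ U := by
  have h : Submodule.span (ZMod 2) (Set.range W.τ) ≤ U := by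
    rw [W.span_τ, Submodule.span_le]
    rintro _ ⟨i, rfl⟩
    exact hU i
  exact h (Submodule.subset_span ⟨j, rfl⟩)

theorem add_sum_mem_iff {U : Submodule (ZMod 2) (BVec n)} (hU : ∀ j, W.τ j ∈ U) (v : BVec n)
    (c : Fin (kd - kc) → ZMod 2) : v + ∑ k, c k • W.τ k ∈ U ↔ v ∈ U :=
  U.add_mem_iff_left (U.sum_mem fun k _ => U.smul_mem _ (hU k))

theorem zT_mem {H : Subgroup (QOp (n + al + ar))ˣ}
    (hH : iOp _ ∈ H) (hpos : ∀ m, W.opZ e (.zT (pos m)) ∈ H)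
    (hcompl : ∀ j : {j // j ∉ Set.range pos}, W.opZ e (.zT j) ∈ H) (j : Fin (kd - kc)) :
    pauliZ (placeMap n al ar al (W.τ j)) ∈ H := by
  rw [← signOp_mul_mem_iff hH (e j), ← opZ_zT]
  by_cases hjp : j ∈ Set.range pos
  · obtain ⟨m, rfl⟩ := hjp
    exact hpos m
  · exact hcompl ⟨j, hjp⟩

end VirtualVectors

open VirtualVectors

/-- The parameters of a code in which the operators `X̂(τ_j)` carry `t` classical bits and some of
the operators `Ẑ(τ_j)` carry `γ` further ones. -/
theorem hasParameters_of_stabilized (h : IsNestedPair C D kc kd p q) (W : VirtualVectors V al ar)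
    (Q : HybridSubsystemCode (n + al + ar)) {γ : ℕ} {e : Fin (kd - kc) → ZMod 2}
    {w : BVec γ → BVec n} {pos : Fin γ → Fin (kd - kc)} (hw : W.IsZPhase e w pos)
    (φ : Q.Message ≃ BVec (kd - kc) × BVec γ)
    (hstab : ∀ b, Q.stab b = Subgroup.closure (commonGenerators n kd q al ar ∪
      zGenerators n (kd - kc) p al ar (w (φ b).2) ∪
      xGenerators n (kd - kc) p al ar (phaseX n q (φ b).1)))
    (hgauge : ∀ b, Q.gauge b = Subgroup.closure ({iOp _} ∪ (commonGenerators n kd q al ar ∪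
      zGenerators n (kd - kc) p al ar (w (φ b).2) ∪
      xGenerators n (kd - kc) p al ar (phaseX n q (φ b).1)) ∪ ∅)) :
    Q.HasParameters (2 * kc - n) (kd - kc + γ) 0 := by
  have hcard := hw.card_add
  have h1 := h.kc_lt_kd
  have h2 := h.kd_le
  have h3 := h.lt_two_mul
  let f : Fin (2 * kc - n) ⊕ (Fin (kd - kc) ⊕ Fin γ) ⊕ Empty ⊕
      ((Fin (al + ar) ⊕ Fin (n - kd) ⊕ Fin (n - kd)) ⊕ {j // j ∉ Set.range pos}) →
      VirtualIndex (2 * kc - n) (kd - kc) (al + ar) (n - kd) :=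
    Sum.elim .logical (Sum.elim (Sum.elim .xT fun m => .zT (pos m)) (Sum.elim Empty.elim
      (Sum.elim commonIndex fun j => .zT j)))
  have hf : Function.Injective f := by
    refine .sumElim (fun _ _ => VirtualIndex.logical.inj) (.sumElim (.sumElim
      (fun _ _ => VirtualIndex.xT.inj) (fun _ _ hij => hw.injective (VirtualIndex.zT.inj hij)) ?_)
      (.sumElim (fun i => i.elim) (.sumElim commonIndex_injective
        (fun _ _ hij => Subtype.ext (VirtualIndex.zT.inj hij)) ?_) ?_) ?_) ?_
    · rintro i j ⟨⟩
    · rintro (i | i | i) j ⟨⟩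
    · exact fun i => i.elim
    · rintro (i | i) (j | (j | j | j) | j) hij
      any_goals cases hij
      · exact j.elim
      · exact j.elim
      · exact j.2 ⟨i, VirtualIndex.zT.inj hij⟩
    · rintro i ((j | j) | j | (j | j | j) | j) hij
      any_goals cases hij
      exact j.elim
  have hS : (Set.range fun i => W.opZ e (f (.inr (.inr (.inr i))))) =
      commonGenerators n kd q al ar ∪
        Set.range fun j : {j // j ∉ Set.range pos} => W.opZ e (.zT j) :=
    (Sum.range_eq _).trans (congrArg₂ _ (W.range_opZ_commonIndex e) rfl)
  have key := Q.hasParameters_of_fintype (by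
    simp only [Fintype.card_sum, Fintype.card_fin, Fintype.card_empty]
    omega) (W.opX ∘ f) (W.opZ e ∘ f)
    (φ.trans (Equiv.sumArrowEquivProdArrow _ _ _).symm) ((W.isVirtualPauliFamily e).comp hf)
    (by
      intro b
      have hM : (Set.range fun j => signOp (n + al + ar)
          (φ.trans (Equiv.sumArrowEquivProdArrow _ _ _).symm b j) * W.opZ e (f (.inr (.inl j)))) =
          (Set.range fun j => signOp _ ((φ b).1 j) * pauliX (extMap n al ar (W.τ j))) ∪
          (Set.range fun m => signOp _ ((φ b).2 m) * W.opZ e (.zT (pos m))) :=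
        (Sum.range_eq _).trans (congrArg₂ _ (congrArg _ (funext fun j =>
          congrArg (signOp _ ((φ b).1 j) * ·) (W.opZ_xT e j))) rfl)
      refine (hstab b).trans (Eq.trans ?_
        (congrArg Subgroup.closure (congrArg₂ (· ∪ ·) hM hS)).symm)
      have hx := W.closure_xGenerators (phaseX n q (φ b).1)
      simp only [W.τ_dotProduct_phaseX] at hx
      have hz := W.closure_zGenerators (w (φ b).2)
      rw [hw.range_eq] at hz
      simp only [Subgroup.closure_union, hx, hz]
      ac_rfl)
    (by
      intro b
      refine (hgauge b).trans ?_
      apply le_antisymm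
      · refine Subgroup.closure_le_closure_of_forall fun H hsub => ?_
        have hi : iOp _ ∈ H := hsub (.inl (.inl (.inl (.inl rfl))))
        have hSH := hS.symm.subset.trans (Set.subset_union_right.trans hsub)
        have hx := W.span_le_xPart (H := H) fun j => by
          rw [← W.opZ_xT e]
          exact hsub (.inl (.inl (.inl (.inr ⟨.inl j, rfl⟩))))
        have hz := W.span_le_zPart (H := H) (W.zT_mem hi
          (fun m => hsub (.inl (.inl (.inl (.inr ⟨.inr m, rfl⟩)))))
          fun j => hsub (.inr ⟨.inr j, rfl⟩))
        rintro _ ((rfl | ((hg | ⟨j, rfl⟩) | ⟨j, rfl⟩)) | hg)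
        · exact hi
        · exact hSH (.inl hg)
        · exact (signOp_mul_mem_iff hi _ _).mpr (hz (Submodule.subset_span ⟨j, rfl⟩))
        · exact (signOp_mul_mem_iff hi _ _).mpr (hx (Submodule.subset_span ⟨j, rfl⟩))
        · exact hg.elim
      · refine Subgroup.closure_le_closure_of_forall fun H hsub => ?_
        have hi : iOp _ ∈ H := hsub (.inl (.inl rfl))
        have hx : ∀ j, W.τ j ∈ xPart H (extMap n al ar) := W.τ_mem fun j =>
          (signOp_mul_mem_iff hi _ _).mp (hsub (.inl (.inr (.inr ⟨j, rfl⟩))))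
        have hz : ∀ j, W.τ j ∈ zPart H (placeMap n al ar al) := W.τ_mem fun j =>
          (signOp_mul_mem_iff hi _ _).mp (hsub (.inl (.inr (.inl (.inr ⟨j, rfl⟩)))))
        have hzT : ∀ j, W.opZ e (.zT j) ∈ H := fun j => by
          rw [W.opZ_zT]
          exact (signOp_mul_mem_iff hi _ _).mpr (hz j)
        rintro _ ((((rfl | ⟨j | m, rfl⟩) | ⟨g, rfl⟩) | ⟨g, rfl⟩) | hg)
        · exact hi
        · exact show W.opZ e (.xT j) ∈ H from (W.opZ_xT e j).symm ▸ hx j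
        · exact hzT _
        · exact g.elim
        · exact g.elim
        · rcases hS.subset hg with hg | ⟨j, rfl⟩
          · exact hsub (.inl (.inr (.inl (.inl hg))))
          · exact hzT j)
  simpa using key

/-- The parameters of a code in which the pairs `X̂(τ_j)`, `Ẑ(q'_j)` are `t` gauge qubits and some
of the operators `Ẑ(τ_j)` carry `γ` classical bits. -/
theorem hasParameters_of_half_gauge (h : IsNestedPair C D kc kd p q) (W : VirtualVectors V al ar)
    (Q : HybridSubsystemCode (n + al + ar)) {γ : ℕ} {e : Fin (kd - kc) → ZMod 2}
    {w : BVec γ → BVec n} {pos : Fin γ → Fin (kd - kc)} (hw : W.IsZPhase e w pos)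
    (φ : Q.Message ≃ BVec γ)
    (hstab : ∀ b, Q.stab b = Subgroup.closure (commonGenerators n kd q al ar ∪
      zGenerators n (kd - kc) p al ar (w (φ b))))
    (hgauge : ∀ b, Q.gauge b = Subgroup.closure ({iOp _} ∪ (commonGenerators n kd q al ar ∪
      zGenerators n (kd - kc) p al ar (w (φ b))) ∪ (xGenerators n (kd - kc) p al ar 0 ∪
      Set.range fun m : Fin (kd - kc) => signOp _ (V.qPrime m ⬝ᵥ w (φ b)) *
        pauliZ (placeAt al ar al (V.qPrime m))))) :
    Q.HasParameters (2 * kc - n) γ (kd - kc) := by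
  have hcard := hw.card_add
  have h1 := h.kc_lt_kd
  have h2 := h.kd_le
  have h3 := h.lt_two_mul
  let f : Fin (2 * kc - n) ⊕ Fin γ ⊕ Fin (kd - kc) ⊕
      ((Fin (al + ar) ⊕ Fin (n - kd) ⊕ Fin (n - kd)) ⊕ {j // j ∉ Set.range pos}) →
      VirtualIndex (2 * kc - n) (kd - kc) (al + ar) (n - kd) :=
    Sum.elim .logical (Sum.elim (fun m => .zT (pos m)) (Sum.elim .xT
      (Sum.elim commonIndex fun j => .zT j)))
  have hf : Function.Injective f := by
    refine .sumElim (fun _ _ => VirtualIndex.logical.inj) (.sumElim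
      (fun _ _ hij => hw.injective (VirtualIndex.zT.inj hij))
      (.sumElim (fun _ _ => VirtualIndex.xT.inj) (.sumElim commonIndex_injective
        (fun _ _ hij => Subtype.ext (VirtualIndex.zT.inj hij)) ?_) ?_) ?_) ?_
    · rintro (i | i | i) j ⟨⟩
    · rintro i ((j | j | j) | j) ⟨⟩
    · rintro i (j | (j | j | j) | j) hij
      any_goals cases hij
      exact j.2 ⟨i, VirtualIndex.zT.inj hij⟩
    · rintro i (j | j | (j | j | j) | j) ⟨⟩
  have hS : (Set.range fun i => W.opZ e (f (.inr (.inr (.inr i))))) =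
      commonGenerators n kd q al ar ∪
        Set.range fun j : {j // j ∉ Set.range pos} => W.opZ e (.zT j) :=
    (Sum.range_eq _).trans (congrArg₂ _ (W.range_opZ_commonIndex e) rfl)
  have key := Q.hasParameters_of_fintype (by
    simp only [Fintype.card_sum, Fintype.card_fin]
    omega) (W.opX ∘ f) (W.opZ e ∘ f) φ ((W.isVirtualPauliFamily e).comp hf)
    (by
      intro b
      refine (hstab b).trans (Eq.trans ?_
        (congrArg Subgroup.closure (congrArg₂ (· ∪ ·) rfl hS)).symm)
      have hz := W.closure_zGenerators (w (φ b))
      rw [hw.range_eq] at hz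
      simp only [Subgroup.closure_union, hz]
      exact sup_left_comm _ _ _)
    (by
      intro b
      refine (hgauge b).trans ?_
      apply le_antisymm
      · refine Subgroup.closure_le_closure_of_forall fun H hsub => ?_
        have hi : iOp _ ∈ H := hsub (.inl (.inl (.inl (.inl rfl))))
        have hSH := hS.symm.subset.trans (Set.subset_union_right.trans hsub)
        have hx := W.span_le_xPart (H := H) fun j => by
          rw [← W.opZ_xT e]
          exact hsub (.inl (.inr ⟨j, rfl⟩))
        have hτ : ∀ j, W.τ j ∈ zPart H (placeMap n al ar al) := W.zT_mem hi
          (fun m => hsub (.inl (.inl (.inl (.inr ⟨m, rfl⟩))))) fun j => hsub (.inr ⟨.inr j, rfl⟩)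
        have hz := W.span_le_zPart (H := H) hτ
        rintro _ ((rfl | (hg | ⟨j, rfl⟩)) | (⟨j, rfl⟩ | ⟨m, rfl⟩))
        · exact hi
        · exact hSH (.inl hg)
        · exact (signOp_mul_mem_iff hi _ _).mpr (hz (Submodule.subset_span ⟨j, rfl⟩))
        · exact (signOp_mul_mem_iff hi _ _).mpr (hx (Submodule.subset_span ⟨j, rfl⟩))
        · refine (signOp_mul_mem_iff hi _ _).mpr ((W.add_sum_mem_iff hτ (V.qPrime m)
            fun k => V.qPrime m ⬝ᵥ V.qPrime k).mp ?_)
          exact (W.opX_xT m).subst (motive := (· ∈ H)) (hsub (.inl (.inl (.inr ⟨m, rfl⟩))))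
      · refine Subgroup.closure_le_closure_of_forall fun H hsub => ?_
        have hi : iOp _ ∈ H := hsub (.inl (.inl rfl))
        have hx : ∀ j, W.τ j ∈ xPart H (extMap n al ar) := W.τ_mem fun j =>
          (signOp_mul_mem_iff hi _ _).mp (hsub (.inr (.inl ⟨j, rfl⟩)))
        have hz : ∀ j, W.τ j ∈ zPart H (placeMap n al ar al) := W.τ_mem fun j =>
          (signOp_mul_mem_iff hi _ _).mp (hsub (.inl (.inr (.inr ⟨j, rfl⟩))))
        have hzT : ∀ j, W.opZ e (.zT j) ∈ H := fun j => by
          rw [W.opZ_zT]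
          exact (signOp_mul_mem_iff hi _ _).mpr (hz j)
        rintro _ ((((rfl | ⟨m, rfl⟩) | ⟨j, rfl⟩) | ⟨j, rfl⟩) | hg)
        · exact hi
        · exact hzT _
        · refine (W.opX_xT j).symm.subst (motive := (· ∈ H)) ?_
          exact (W.add_sum_mem_iff hz _ _).mpr
            ((signOp_mul_mem_iff hi _ _).mp (hsub (.inr (.inr ⟨j, rfl⟩))))
        · exact show W.opZ e (.xT j) ∈ H from (W.opZ_xT e j).symm ▸ hx j
        · rcases hS.subset hg with hg | ⟨j, rfl⟩
          · exact hsub (.inl (.inr (.inl hg)))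
          · exact hzT j)
  simpa using key

/-- The parameters of the code without classical bits in which the `2 t` anticommuting pairs built
from the vectors `t̃_j`, `t^x_j`, `t^z_j` are gauge qubits. -/
theorem hasParameters_of_full_gauge (h : IsNestedPair C D kc kd p q) (W : VirtualVectors V al ar)
    (Q : HybridSubsystemCode (n + al + ar)) (φ : Q.Message ≃ (Empty → ZMod 2))
    (hstab : ∀ b, Q.stab b = Subgroup.closure (commonGenerators n kd q al ar))
    (hgauge : ∀ b, Q.gauge b = Subgroup.closure ({iOp _} ∪ commonGenerators n kd q al ar ∪
      ((Set.range fun j => pauliX (cyclicExtension al ar (V.tt j))) ∪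
      (Set.range fun j => pauliZ (placeAt al ar al (V.tt j))) ∪
      (Set.range fun m => pauliX (cyclicExtension al ar (V.tx m))) ∪
      (Set.range fun m => pauliZ (placeAt al ar al (V.tz m)))))) :
    Q.HasParameters (2 * kc - n) 0 (2 * (kd - kc)) := by
  have h1 := h.kc_lt_kd
  have h2 := h.kd_le
  have h3 := h.lt_two_mul
  let f : Fin (2 * kc - n) ⊕ Empty ⊕ (Fin (kd - kc) ⊕ Fin (kd - kc)) ⊕
      (Fin (al + ar) ⊕ Fin (n - kd) ⊕ Fin (n - kd)) →
      VirtualIndex (2 * kc - n) (kd - kc) (al + ar) (n - kd) :=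
    Sum.elim .logical (Sum.elim Empty.elim (Sum.elim (Sum.elim .xT .zT) commonIndex))
  have hf : Function.Injective f := by
    refine .sumElim (fun _ _ => VirtualIndex.logical.inj) (.sumElim (fun i => i.elim)
      (.sumElim (.sumElim (fun _ _ => VirtualIndex.xT.inj) (fun _ _ => VirtualIndex.zT.inj) ?_)
        commonIndex_injective ?_) ?_) ?_
    · rintro i j ⟨⟩
    · rintro (i | i) (j | j | j) ⟨⟩
    · exact fun i => i.elim
    · rintro i (j | (j | j) | (j | j | j)) hij
      any_goals cases hij
      exact j.elim
  have hS : (Set.range fun i => W.opZ 0 (f (.inr (.inr (.inr i))))) =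
      commonGenerators n kd q al ar := W.range_opZ_commonIndex 0
  have key := Q.hasParameters_of_fintype (by
    simp only [Fintype.card_sum, Fintype.card_fin, Fintype.card_empty]
    omega) (W.opX ∘ f) (W.opZ 0 ∘ f) φ ((W.isVirtualPauliFamily 0).comp hf)
    (by
      intro b
      refine (hstab b).trans (congrArg Subgroup.closure ?_)
      rw [Set.range_eq_empty, Set.empty_union]
      exact hS.symm)
    (by
      intro b
      refine (hgauge b).trans ?_
      apply le_antisymm
      · refine Subgroup.closure_le_closure_of_forall fun H hsub => ?_
        have hi : iOp _ ∈ H := hsub (.inl (.inl (.inl (.inl rfl))))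
        have hSH := hS.symm.subset.trans (Set.subset_union_right.trans hsub)
        have hx := W.span_le_xPart (H := H) fun j => by
          rw [← W.opZ_xT 0]
          exact hsub (.inl (.inr ⟨.inl j, rfl⟩))
        have hτ : ∀ j, W.τ j ∈ zPart H (placeMap n al ar al) := fun j =>
          (signOp_mul_mem_iff hi _ _).mp ((W.opZ_zT 0 j).subst (motive := (· ∈ H))
            (hsub (.inl (.inr ⟨.inr j, rfl⟩))))
        have hz := W.span_le_zPart (H := H) hτ
        have hqx : ∀ m : Fin (kd - kc), V.qPrime m ∈ xPart H (extMap n al ar) := fun m =>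
          (W.opX_zT m).subst (motive := (· ∈ H)) (hsub (.inl (.inl (.inr ⟨.inr m, rfl⟩))))
        have hqz : ∀ m : Fin (kd - kc), V.qPrime m ∈ zPart H (placeMap n al ar al) := fun m =>
          (W.add_sum_mem_iff hτ _ _).mp ((W.opX_xT m).subst (motive := (· ∈ H))
            (hsub (.inl (.inl (.inr ⟨.inl m, rfl⟩)))))
        have hX := V.span_tx.le.trans (Submodule.span_le.mpr (Set.union_subset
          (Submodule.span_le.mp hx) (Set.range_subset_iff.mpr hqx)))
        have hZ := V.span_tz.le.trans (Submodule.span_le.mpr (Set.union_subset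
          (Submodule.span_le.mp hz) (Set.range_subset_iff.mpr hqz)))
        rintro _ ((rfl | hg) | (((⟨j, rfl⟩ | ⟨j, rfl⟩) | ⟨j, rfl⟩) | ⟨j, rfl⟩))
        · exact hi
        · exact hSH hg
        · exact hX (Submodule.subset_span (.inl ⟨j, rfl⟩))
        · exact hZ (Submodule.subset_span (.inl ⟨j, rfl⟩))
        · exact hX (Submodule.subset_span (.inr ⟨j, rfl⟩))
        · exact hZ (Submodule.subset_span (.inr ⟨j, rfl⟩))
      · refine Subgroup.closure_le_closure_of_forall fun H hsub => ?_
        have hi : iOp _ ∈ H := hsub (.inl (.inl rfl))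
        have hX := V.span_tx.ge.trans (Submodule.span_le (p := xPart H (extMap n al ar)).mpr
          (Set.union_subset
            (Set.range_subset_iff.mpr fun j => hsub (.inr (.inl (.inl (.inl ⟨j, rfl⟩)))))
            (Set.range_subset_iff.mpr fun j => hsub (.inr (.inl (.inr ⟨j, rfl⟩))))))
        have hZ := V.span_tz.ge.trans (Submodule.span_le (p := zPart H (placeMap n al ar al)).mpr
          (Set.union_subset
            (Set.range_subset_iff.mpr fun j => hsub (.inr (.inl (.inl (.inr ⟨j, rfl⟩)))))
            (Set.range_subset_iff.mpr fun j => hsub (.inr (.inr ⟨j, rfl⟩)))))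
        have hx : ∀ j, W.τ j ∈ xPart H (extMap n al ar) := W.τ_mem fun j =>
          hX (Submodule.subset_span (.inl ⟨j, rfl⟩))
        have hz : ∀ j, W.τ j ∈ zPart H (placeMap n al ar al) := W.τ_mem fun j =>
          hZ (Submodule.subset_span (.inl ⟨j, rfl⟩))
        rintro _ ((((rfl | ⟨g, rfl⟩) | ⟨j | j, rfl⟩) | ⟨j | j, rfl⟩) | hg)
        · exact hi
        · exact g.elim
        · refine (W.opX_xT j).symm.subst (motive := (· ∈ H)) ?_
          exact (W.add_sum_mem_iff hz _ _).mpr (hZ (Submodule.subset_span (.inr ⟨j, rfl⟩)))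
        · refine (W.opX_zT j).symm.subst (motive := (· ∈ H)) ?_
          exact hX (Submodule.subset_span (.inr ⟨j, rfl⟩))
        · exact show W.opZ 0 (.xT j) ∈ H from (W.opZ_xT 0 j).symm ▸ hx j
        · exact (W.opZ_zT 0 j).symm.subst (motive := (· ∈ H))
            ((signOp_mul_mem_iff hi _ _).mpr (hz j))
        · exact hsub (.inl (.inr (hS.subset hg))))
  rw [two_mul (kd - kc)]
  simpa using key

end Parameters

/-! ### Correction of misalignment -/

section Misalignment

variable {n : ℕ} [NeZero n]

/-- Moving the window by one position adds a multiple of a `Z Z` vector: the entry that leaves the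
window on the left is the one that enters it on the right. -/
theorem placeMap_succ (al ar s : ℕ) (v : BVec n) :
    placeMap n al ar (s + 1) (cyclicShift v (al - (s + 1 : ℕ))) =
      placeMap n al ar s (cyclicShift v (al - s)) +
        cyclicEntry v ((s : ℤ) - al) • ancillaVec n al ar s := by
  have hn : n ≠ 0 := NeZero.ne n
  funext x
  change (if s + 1 ≤ (x : ℕ) ∧ (x : ℕ) < s + 1 + n then cyclicEntry _ _ else 0) =
    (if s ≤ (x : ℕ) ∧ (x : ℕ) < s + n then cyclicEntry _ _ else 0) +
      _ * (if (x : ℕ) = s ∨ (x : ℕ) = s + n then 1 else 0)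
  rw [cyclicEntry_cyclicShift, cyclicEntry_cyclicShift]
  have h1 : ((x : ℕ) : ℤ) - (s + 1 : ℕ) - (al - (s + 1 : ℕ)) = (x : ℕ) - al := by ring
  have h2 : ((x : ℕ) : ℤ) - s - (al - s) = (x : ℕ) - al := by ring
  rw [h1, h2]
  by_cases hs : (x : ℕ) = s
  · rw [if_neg (by omega), if_pos (by omega), if_pos (by omega), hs, mul_one,
      CharTwo.add_self_eq_zero]
  · by_cases hsn : (x : ℕ) = s + n
    · have h3 : ((s + n : ℕ) : ℤ) - al = (s - al) + n := by
        push_cast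
        ring
      rw [if_pos (by omega), if_neg (by omega), if_pos (by omega), hsn, h3, cyclicEntry_add_self,
        mul_one, zero_add]
    · rw [if_neg (c := (x : ℕ) = s ∨ (x : ℕ) = s + n) (by omega), mul_zero, add_zero]
      congr 1
      apply propext
      omega

/-- A group that contains the `Z Z` operators contains with a `Z`-type operator on one window the
operator on another window that agrees with it after the periodic continuation. -/
theorem pauliZ_placeMap_add_mem {al ar : ℕ} {H : Subgroup (QOp (n + al + ar))ˣ}
    (hH : ∀ i < al + ar, pauliZ (ancillaVec n al ar i) ∈ H) (v : BVec n) {s : ℕ}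
    (hs : s ≤ al + ar) :
    pauliZ (placeMap n al ar s (cyclicShift v (al - s)) + placeMap n al ar al v) ∈ H := by
  let U := zPart H LinearMap.id
  have hU : ∀ s ≤ al + ar, placeMap n al ar s (cyclicShift v (al - s)) +
      placeMap n al ar 0 (cyclicShift v (al - (0 : ℕ))) ∈ U := by
    intro s
    induction s with
    | zero =>
      intro _
      have : ∀ x : BVec (n + al + ar), x + x = 0 := fun x => by
        funext i
        exact CharTwo.add_self_eq_zero _
      rw [this]
      exact U.zero_mem
    | succ s ih =>
      intro hs
      rw [placeMap_succ, add_right_comm (placeMap n al ar s _)]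
      exact U.add_mem (ih (by omega)) (U.smul_mem _ (hH s (by omega)))
  have h1 := U.add_mem (hU s hs) (hU al (by omega))
  rw [sub_self, cyclicShift_zero, add_add_add_comm] at h1
  have h2 : ∀ x y : BVec (n + al + ar), x + (y + y) = x := fun x y => by
    funext i
    simp [CharTwo.add_self_eq_zero]
  rw [h2] at h1
  exact h1

theorem cyclicShift_dotProduct (c d : BVec n) (α : ℤ) :
    cyclicShift c α ⬝ᵥ d = c ⬝ᵥ cyclicShift d (-α) := by
  rw [← cyclicShift_dotProduct_cyclicShift c _ α, cyclicShift_cyclicShift, neg_add_cancel,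
    cyclicShift_zero]

theorem isCyclicCode_dualCode {C : Submodule (ZMod 2) (BVec n)} (hC : IsCyclicCode C) :
    IsCyclicCode (dualCode C) := by
  intro w hw α c hc
  rw [dotProduct_comm, cyclicShift_dotProduct, dotProduct_comm]
  exact hw _ (hC c hc _)

variable {C D : Submodule (ZMod 2) (BVec n)} {kc kd : ℕ} {p q : (ZMod 2)[X]}

/-- The group generated by the common generators and the signed `Ẑ(p̃_j)` contains the signed `Ẑ(v)`
for all `v` in the dual code of `C`. -/
theorem IsNestedPair.signedZ_mem (h : IsNestedPair C D kc kd p q) {al ar : ℕ}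
    {H : Subgroup (QOp (n + al + ar))ˣ} {w : BVec n} (hw : w ∈ D)
    (hcommon : commonGenerators n kd q al ar ⊆ H)
    (hz : zGenerators n (kd - kc) p al ar w ⊆ H) {v : BVec n} (hv : v ∈ dualCode C) :
    signOp _ (v ⬝ᵥ w) * pauliZ (placeMap n al ar al v) ∈ H := by
  have hle : spanImage (signedZ (placeMap n al ar al) w) (dualCode C) ≤ H := by
    rw [← h.span_pt_sup, ← h.span_qt, spanImage_sup, ← closure_range_eq_spanImage,
      ← closure_range_eq_spanImage]
    refine sup_le ((Subgroup.closure_le _).mpr hz) ((Subgroup.closure_le _).mpr ?_)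
    rintro _ ⟨i, rfl⟩
    dsimp only
    rw [signedZ_apply, dotProduct_comm, h.genVec_qt_mem i w hw, signOp_zero, one_mul]
    exact hcommon (.inl (.inr ⟨i, rfl⟩))
  exact hle (apply_mem_spanImage _ hv)

/-- Without ancilla qubits there is only one possible position, so that nothing has to be
measured. -/
theorem correctsMisalignment_zero (Q : HybridSubsystemCode (n + 0 + 0)) :
    Q.CorrectsMisalignment := by
  refine ⟨0, fun _ => 0, fun _ => 0, fun _ => 0, fun _ _ => 0, fun j => j.elim0,
    fun _ _ _ j => j.elim0, fun _ _ s hs s' hs' _ => by omega⟩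

variable {V : PairedGenerators n kc kd p q} {al ar : ℕ}

theorem VirtualVectors.τ_dotProduct_genVec (W : VirtualVectors V al ar) (j : Fin (kd - kc)) {m : ℕ}
    (hm : m < kd - kc) : W.τ j ⬝ᵥ genVec n q m = if (j : ℕ) = m then 1 else 0 := by
  rw [W.τ_q j ⟨m, hm⟩]
  simp [Fin.ext_iff]

/-- The signs measured on a shifted marker. Their first nonzero entry is at the position of the
shift. -/
theorem VirtualVectors.τ_dotProduct_cyclicShift (W : VirtualVectors V al ar) {γ : ℕ} (c : BVec γ)
    {a : ℕ} (ha : a + γ < kd - kc) (j : Fin (kd - kc)) :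
    W.τ j ⬝ᵥ cyclicShift (genVec n q 0 + ∑ m : Fin γ, c m • genVec n q (m + 1)) a =
      (if (j : ℕ) = a then 1 else 0) + ∑ m : Fin γ, c m * if (j : ℕ) = m + 1 + a then 1 else 0 := by
  rw [cyclicShift_add, cyclicShift_sum_smul, dotProduct_add, dotProduct_sum_smul,
    cyclicShift_genVec, zero_add, W.τ_dotProduct_genVec j (by omega)]
  congr 1
  refine Finset.sum_congr rfl fun m _ => ?_
  rw [cyclicShift_genVec, W.τ_dotProduct_genVec j (by omega)]

/-- A marker whose shifts stay within the vectors `q_1, …, q_t` reveals the position of the received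
qubits. -/
theorem correctsMisalignment_of_marker (h : IsNestedPair C D kc kd p q)
    (W : VirtualVectors V al ar) (Q : HybridSubsystemCode (n + al + ar)) {γ : ℕ}
    (hγ : al + ar + γ < kd - kc) (c : Q.Message → BVec γ)
    (hcommon : ∀ b, commonGenerators n kd q al ar ⊆ Q.stab b)
    (hz : ∀ b, zGenerators n (kd - kc) p al ar
      (genVec n q 0 + ∑ m : Fin γ, c b m • genVec n q (m + 1)) ⊆ Q.stab b) :
    Q.CorrectsMisalignment := by
  let w : Q.Message → BVec n := fun b => genVec n q 0 + ∑ m : Fin γ, c b m • genVec n q (m + 1)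
  have hwD : ∀ b, w b ∈ D := fun b => D.add_mem (h.genVec_q_mem 0)
    (D.sum_mem fun m _ => D.smul_mem _ (h.genVec_q_mem _))
  have hτC : ∀ j, W.τ j ∈ dualCode C := W.τ_mem h.genVec_pt_mem
  -- The shift of `τ_j` by `-ar` turns the shifts of `w b` by `al - s` into ones by `al + ar - s ≥ 0`.
  refine ⟨kd - kc, fun _ => 0, fun _ => 0, fun j => cyclicShift (W.τ j) (-ar),
    fun b s j => W.τ j ⬝ᵥ cyclicShift (w b) ((al + ar - s : ℕ) : ℤ), ?_, ?_, ?_⟩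
  · intro j j'
    rw [pauliX_zero, one_mul, one_mul, pauliZ_comm]
  · intro b s hs j
    let v := cyclicShift (W.τ j) (s - al - ar)
    have hv : v ∈ dualCode C := isCyclicCode_dualCode h.cyclic_C _ (hτC j) _
    have hvw : v ⬝ᵥ w b = W.τ j ⬝ᵥ cyclicShift (w b) ((al + ar - s : ℕ) : ℤ) := by
      rw [cyclicShift_dotProduct]
      congr 2
      omega
    have hshift : cyclicShift (W.τ j) (-ar) = cyclicShift v (al - s) := by
      rw [cyclicShift_cyclicShift]
      congr 1
      ring
    have h1 := h.signedZ_mem (hwD b) (hcommon b) (hz b) hv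
    have h2 := pauliZ_placeMap_add_mem (H := Q.stab b)
      (fun i hi => hcommon b (.inr ⟨⟨i, hi⟩, rfl⟩)) v hs
    have h3 := (Q.stab b).mul_mem h1 h2
    have h4 : pauliX (placeAt al ar s (0 : BVec n)) = 1 :=
      (congrArg pauliX (map_zero (placeMap n al ar s))).trans (pauliX_zero _)
    dsimp only
    rw [h4, pow_zero, one_mul, one_mul, hshift, ← hvw]
    rw [pauliZ_add, mul_assoc, ← mul_assoc (pauliZ _) (pauliZ _) (pauliZ _),
      pauliZ_comm (placeMap n al ar al v), mul_assoc (pauliZ _) (pauliZ _) (pauliZ _),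
      pauliZ_mul_self, mul_one] at h3
    exact h3
  · intro b b' s hs s' hs' hout
    -- The first nonzero measured sign is at the position `al + ar - s`.
    have key : ∀ (b b' : Q.Message) (a a' : ℕ), a ≤ al + ar → a' ≤ al + ar → a < a' →
        (fun j => W.τ j ⬝ᵥ cyclicShift (w b) (a : ℤ)) ≠
          fun j => W.τ j ⬝ᵥ cyclicShift (w b') (a' : ℤ) := by
      intro b b' a a' ha ha' hlt heq
      let j : Fin (kd - kc) := ⟨a, by omega⟩
      have hja : (j : ℕ) = a := rfl
      have hj := congrFun heq j
      rw [W.τ_dotProduct_cyclicShift (c b) (by omega), W.τ_dotProduct_cyclicShift (c b') (by omega),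
        if_pos hja, if_neg (by omega), Finset.sum_eq_zero, Finset.sum_eq_zero] at hj
      · simp at hj
      · intro m _
        rw [if_neg (by omega), mul_zero]
      · intro m _
        rw [if_neg (by omega), mul_zero]
    rcases lt_trichotomy (al + ar - s) (al + ar - s') with hlt | heq | hlt
    · exact (key b b' _ _ (by omega) (by omega) hlt hout).elim
    · omega
    · exact (key b' b _ _ (by omega) (by omega) hlt hout.symm).elim

/-- The phases that encode the bits `c_m` by `base + ∑_m c_m q_m`, with `m` starting from `off`. -/
theorem VirtualVectors.isZPhase (W : VirtualVectors V al ar) {γ off : ℕ} (hle : off + γ ≤ kd - kc)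
    (base : BVec n) {w : BVec γ → BVec n}
    (hw : ∀ c, w c = base + ∑ m : Fin γ, c m • genVec n q (m + off)) :
    W.IsZPhase (fun j => W.τ j ⬝ᵥ base) w fun m => ⟨m + off, by omega⟩ := by
  have hτ : ∀ (c : BVec γ) (j : Fin (kd - kc)), W.τ j ⬝ᵥ w c = W.τ j ⬝ᵥ base +
      ∑ m : Fin γ, c m * if (j : ℕ) = m + off then 1 else 0 := by
    intro c j
    rw [hw, dotProduct_add, dotProduct_sum_smul]
    congr 1
    exact Finset.sum_congr rfl fun m _ => by rw [W.τ_dotProduct_genVec j (by omega)]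
  constructor
  · intro m m' hmm
    have := congrArg Fin.val hmm
    dsimp only at this
    ext
    omega
  · intro c m
    rw [hτ]
    simp [Fin.val_inj]
  · intro c j hj
    rw [hτ, Finset.sum_eq_zero, add_zero]
    intro m _
    rw [if_neg, mul_zero]
    exact fun hjm => hj ⟨m, Fin.ext hjm.symm⟩

end Misalignment

/-! ### The seven types of codes -/

section Types

variable {n : ℕ} [NeZero n] {kc kd : ℕ} {p q : (ZMod 2)[X]}

/-- A type that allows up to `t - γ - 1` ancilla qubits has maximum synchronization distance
`t - γ`. -/
theorem isGreatest_syncDistances {V : PairedGenerators n kc kd p q} {κ : CodeKind} {γ : ℕ}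
    (hγ : γ < kd - kc)
    (hadm : ∀ al ar, κ.Admissible (kd - kc) al ar ↔ al + ar < kd - kc - γ)
    (hcorr : ∀ al ar, κ.Admissible (kd - kc) al ar →
      (familyCode V κ al ar).CorrectsMisalignment) :
    IsGreatest (syncDistances V κ) (kd - kc - γ) := by
  constructor
  · have h : κ.Admissible (kd - kc) (kd - kc - γ - 1) 0 := (hadm _ _).mpr (by omega)
    exact ⟨_, _, h, hcorr _ _ h, by omega⟩
  · rintro d ⟨al, ar, h, -, rfl⟩
    have := (hadm al ar).mp h
    omega

theorem isGreatest_syncDistances_one {V : PairedGenerators n kc kd p q} {κ : CodeKind}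
    (hadm : ∀ al ar, κ.Admissible (kd - kc) al ar ↔ al = 0 ∧ ar = 0) :
    IsGreatest (syncDistances V κ) 1 := by
  constructor
  · exact ⟨0, 0, (hadm 0 0).mpr ⟨rfl, rfl⟩, correctsMisalignment_zero _, rfl⟩
  · rintro d ⟨al, ar, h, -, rfl⟩
    obtain ⟨rfl, rfl⟩ := (hadm al ar).mp h
    exact le_rfl

/-- The claim on one type of codes: parameters common to all admissible numbers of ancilla qubits,
the maximum synchronization distance, and the sum that they make up. -/
def HasTradeoff (V : PairedGenerators n kc kd p q) (κ : CodeKind) : Prop :=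
  ∃ r m dmax : ℕ,
    (∀ al ar : ℕ, κ.Admissible (kd - kc) al ar →
      (familyCode V κ al ar).HasParameters (2 * kc - n) m r ∧
      (familyCode V κ al ar).CorrectsMisalignment) ∧
    IsGreatest (syncDistances V κ) dmax ∧
    (κ.IsSynchronizable →
      r + m + dmax = 2 * (kd - kc) ∧ (2 ≤ kd - kc → 1 < dmax)) ∧
    (¬ κ.IsSynchronizable →
      dmax = 1 ∧ r + m + dmax = 2 * (kd - kc) + 1)

variable {C D : Submodule (ZMod 2) (BVec n)} {V : PairedGenerators n kc kd p q} {κ : CodeKind}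

theorem hasTradeoff_of_isSynchronizable (h : IsNestedPair C D kc kd p q) {m r γ : ℕ}
    (hγ : γ < kd - kc) (hsyn : κ.IsSynchronizable) (htwo : 2 ≤ kd - kc → γ + 2 ≤ kd - kc)
    (hrm : r + m = kd - kc + γ)
    (hadm : ∀ al ar, κ.Admissible (kd - kc) al ar ↔ al + ar < kd - kc - γ)
    (hcode : ∀ al ar, VirtualVectors V al ar → al + ar + γ < kd - kc →
      (familyCode V κ al ar).HasParameters (2 * kc - n) m r ∧
      (familyCode V κ al ar).CorrectsMisalignment) :
    HasTradeoff V κ := by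
  have hcode' : ∀ al ar : ℕ, κ.Admissible (kd - kc) al ar →
      (familyCode V κ al ar).HasParameters (2 * kc - n) m r ∧
      (familyCode V κ al ar).CorrectsMisalignment := by
    intro al ar ha
    have := (hadm al ar).mp ha
    have hle := h.kd_le
    obtain ⟨W⟩ := h.nonempty_virtualVectors V (show al + ar ≤ n by omega)
    exact hcode al ar W (by omega)
  exact ⟨r, m, kd - kc - γ, hcode',
    isGreatest_syncDistances hγ hadm fun al ar ha => (hcode' al ar ha).2,
    fun _ => ⟨by omega, fun h2 => by have := htwo h2; omega⟩, fun hn => (hn hsyn).elim⟩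

theorem hasTradeoff_of_not_isSynchronizable (h : IsNestedPair C D kc kd p q) {m r : ℕ}
    (hsyn : ¬κ.IsSynchronizable) (hrm : r + m = 2 * (kd - kc))
    (hadm : ∀ al ar, κ.Admissible (kd - kc) al ar ↔ al = 0 ∧ ar = 0)
    (hcode : VirtualVectors V 0 0 → (familyCode V κ 0 0).HasParameters (2 * kc - n) m r) :
    HasTradeoff V κ := by
  refine ⟨r, m, 1, fun al ar ha => ?_, isGreatest_syncDistances_one hadm,
    fun hs => (hsyn hs).elim, fun _ => ⟨rfl, by omega⟩⟩
  obtain ⟨rfl, rfl⟩ := (hadm al ar).mp ha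
  obtain ⟨W⟩ := h.nonempty_virtualVectors V (al := 0) (ar := 0) (Nat.zero_le n)
  exact ⟨hcode W, correctsMisalignment_zero _⟩

end Types

theorem mainTheorem2 {n : ℕ} [NeZero n] (C D : Submodule (ZMod 2) (BVec n))
    (hC : IsCyclicCode C) (hD : IsCyclicCode D) (hCC : dualCode C < C) (hCD : C < D)
    (kc kd : ℕ) (hkc : Module.finrank (ZMod 2) C = kc) (hkd : Module.finrank (ZMod 2) D = kd)
    (p q : Polynomial (ZMod 2)) (hp : IsGeneratorPolynomial C p)
    (hq : IsGeneratorPolynomial D q) :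
    Nonempty (PairedGenerators n kc kd p q) ∧
    ∀ (V : PairedGenerators n kc kd p q) (κ : CodeKind), κ.Valid (kd - kc) →
      ∃ r m dmax : ℕ,
        (∀ al ar : ℕ, κ.Admissible (kd - kc) al ar →
          (familyCode V κ al ar).HasParameters (2 * kc - n) m r ∧
          (familyCode V κ al ar).CorrectsMisalignment) ∧
        IsGreatest (syncDistances V κ) dmax ∧
        (κ.IsSynchronizable →
          r + m + dmax = 2 * (kd - kc) ∧ (2 ≤ kd - kc → 1 < dmax)) ∧
        (¬ κ.IsSynchronizable →
          dmax = 1 ∧ r + m + dmax = 2 * (kd - kc) + 1) := by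
  have h : IsNestedPair C D kc kd p q := ⟨hC, hD, hCC, hCD, hkc, hkd, hp, hq⟩
  have hlt := h.kc_lt_kd
  refine ⟨h.nonempty_pairedGenerators, fun V κ hκ => ?_⟩
  change HasTradeoff V κ
  cases κ with
  | Q1 =>
    exact hasTradeoff_of_not_isSynchronizable h (m := 0) (r := 2 * (kd - kc)) not_false
      (by omega) (fun _ _ => Iff.rfl) fun W =>
      hasParameters_of_full_gauge h W _ ((Equiv.uniqueProd (BVec 0) (BVec 0)).trans
        (Equiv.ofUnique _ _)) (fun _ => rfl) fun _ => rfl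
  | Q2 =>
    refine hasTradeoff_of_isSynchronizable h (m := 0) (r := kd - kc) (γ := 0) (by omega) trivial
      (by omega) (by omega) (fun _ _ => Iff.rfl) fun al ar W ha => ⟨?_, ?_⟩
    · exact hasParameters_of_half_gauge h W _ (W.isZPhase (by omega) _ fun c => rfl)
        (Equiv.uniqueProd (BVec 0) (BVec 0)) (fun _ => rfl) fun _ => rfl
    · exact correctsMisalignment_of_marker h W _ ha (fun b => b.2)
        (fun b => Set.subset_union_left.trans Subgroup.subset_closure)
        fun b => Set.subset_union_right.trans Subgroup.subset_closure
  | Q3 =>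
    refine hasTradeoff_of_isSynchronizable h (m := kd - kc + 0) (r := 0) (γ := 0) (by omega) trivial
      (by omega) (by omega) (fun _ _ => Iff.rfl) fun al ar W ha => ⟨?_, ?_⟩
    · exact hasParameters_of_stabilized h W _ (W.isZPhase (by omega) _ fun c => rfl)
        (Equiv.refl (BVec (kd - kc) × BVec 0)) (fun _ => rfl) fun _ => rfl
    · exact correctsMisalignment_of_marker h W _ ha (fun b => b.2)
        (fun b => (Set.subset_union_left.trans Set.subset_union_left).trans Subgroup.subset_closure)
        fun b => (Set.subset_union_right.trans Set.subset_union_left).trans Subgroup.subset_closure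
  | Q4 y =>
    obtain ⟨hy1, hy2⟩ := hκ
    refine hasTradeoff_of_isSynchronizable h (m := kd - kc + y) (r := 0) (γ := y) (by omega) trivial
      (by omega) (by omega) (fun _ _ => Iff.rfl) fun al ar W ha => ⟨?_, ?_⟩
    · exact hasParameters_of_stabilized h W _ (W.isZPhase (by omega) _ fun c => rfl)
        (Equiv.refl (BVec (kd - kc) × BVec y)) (fun _ => rfl) fun _ => rfl
    · exact correctsMisalignment_of_marker h W _ ha (fun b => b.2)
        (fun b => (Set.subset_union_left.trans Set.subset_union_left).trans Subgroup.subset_closure)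
        fun b => (Set.subset_union_right.trans Set.subset_union_left).trans Subgroup.subset_closure
  | Q5 =>
    exact hasTradeoff_of_not_isSynchronizable h (m := kd - kc + (kd - kc)) (r := 0) not_false
      (by omega) (fun _ _ => Iff.rfl) fun W => hasParameters_of_stabilized h W _
        (W.isZPhase (off := 0) (by omega) 0 fun c => (zero_add _).symm)
        (Equiv.refl (BVec (kd - kc) × BVec (kd - kc))) (fun _ => rfl) fun _ => rfl
  | Q6 y =>
    obtain ⟨hy1, hy2⟩ := hκ
    refine hasTradeoff_of_isSynchronizable h (m := y) (r := kd - kc) (γ := y) (by omega) trivial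
      (by omega) (by omega) (fun _ _ => Iff.rfl) fun al ar W ha => ⟨?_, ?_⟩
    · exact hasParameters_of_half_gauge h W _ (W.isZPhase (by omega) _ fun c => rfl)
        (Equiv.uniqueProd (BVec y) (BVec 0)) (fun _ => rfl) fun _ => rfl
    · exact correctsMisalignment_of_marker h W _ ha (fun b => b.2)
        (fun b => Set.subset_union_left.trans Subgroup.subset_closure)
        fun b => Set.subset_union_right.trans Subgroup.subset_closure
  | Q7 =>
    exact hasTradeoff_of_not_isSynchronizable h (m := kd - kc) (r := kd - kc) not_false
      (by omega) (fun _ _ => Iff.rfl) fun W => hasParameters_of_half_gauge h W _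
        (W.isZPhase (off := 0) (by omega) 0 fun c => (zero_add _).symm)
        (Equiv.uniqueProd (BVec (kd - kc)) (BVec 0)) (fun _ => rfl) fun _ => rfl
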